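/- Let $V$ be a finite-dimensional real inner product space and let $\Phi\subset V$ be an integral root system, i.e. a finite set with (i) $\Phi=-\Phi$; (ii) if $\alpha,k\alpha\in\Phi$ with $k\in\mathbb{R}$ then $k=\pm1$; (iii) $s_\alpha\Phi=\Phi$ for all $\alpha\in\Phi$, where $s_\alpha(x)=x-2\frac{\langle x,\alpha\rangle}{\langle\alpha,\alpha\rangle}\alpha$; (iv) $2\frac{\langle\alpha,\beta\rangle}{\langle\alpha,\alpha\rangle}\in\mathbb{Z}$ for all $\alpha,\beta\in\Phi$. Let $W$ be its Weyl group (generated by the $s_\alpha$, $\alpha\in\Phi$), $\{\alpha_1,\dots,\alpha_r\}$ a system of simple roots, $P$ the corresponding set of positive roots, $\rho=\frac12\sum_{\alpha\in P}\alpha$, and $\Lambda=\mathbb{Z}w_1+\cdots+\mathbb{Z}w_r$ the weight lattice, where $w_1,\dots,w_r$ is the basis of $\mathrm{span}_{\mathbb{R}}\Phi$ dual to $\frac{2\alpha_1}{\langle\alpha_1,\alpha_1\rangle},\dots,\frac{2\alpha_r}{\langle\alpha_r,\alpha_r\rangle}$. Fix $\mu\in\Lambda$. For $n=(n_1,\dots,n_r)\in\mathbb{Z}^r$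 put $\lambda=\sum_{i=1}^r n_i\alpha_i$, and for $H\in V$ let $$\chi(n,H)=\frac{\sum_{s\in W}\det(s)\,e^{i\langle s(\lambda+\mu),H\rangle}}{\sum_{s\in W}\det(s)\,e^{i\langle s(\rho),H\rangle}},$$ where at the zeros of the denominator (the chamber walls) the quotient is understood as its limit from the complement of the walls. Then the denominator equals $e^{-i\langle\rho,H\rangle}\prod_{\alpha\in P}(e^{i\langle\alpha,H\rangle}-1)$ for every $H\in V$, and for every $n$ the quotient extends to a continuous function $\chi(n,\cdot)$ on all of $V$. Moreover, for all $A,B>0$ and every integer $k\geq0$ there is a constant $C>0$, depending only on $\Phi$, $\{\alpha_i\}$, $\mu$, $A$, $B$ and $k$, such that for all real $N\geq1$, all $H\in V$ with $$\left\|\tfrac{1}{2\pi}\langle\alpha,H\rangle\right\|\leq B N^{-1}\quad\text{for all }\alpha\in P$$ ($\|x\|$ being the distance from $x\in\mathbb{R}$ to the nearest integer), all $n\in\mathbb{Z}^r$ with $|n_i|\leq A N$ for $i=1,\dots,r$, and all $i_1,\dots,i_k\in\{1,\dots,r\}$, $$\left|D_{i_1}\cdots D_{i_k}\chi(n,H)\right|\leq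 C\,N^{|P|-k},$$ where $D_i$ acts on functions of $n$ by $D_if(n)=f(n+e_i)-f(n)$, with $e_i$ the $i$-th standard basis vector of $\mathbb{Z}^r$. -/

import Mathlib

open scoped InnerProductSpace BigOperators

noncomputable section

/-- The orthogonal reflection `s_α` of `V` in the hyperplane `α^⊥`. -/
def rootReflection {V : Type*} [NormedAddCommGroup V] [InnerProductSpace ℝ V]
    (α : V) : V ≃ₗᵢ[ℝ] V :=
  (ℝ ∙ α)ᗮ.reflection

theorem rootReflection_apply {V : Type*} [NormedAddCommGroup V] [InnerProductSpace ℝ V]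
    (α x : V) : rootReflection α x = x - (2 * ⟪x, α⟫_ℝ / ⟪α, α⟫_ℝ) • α := by
  unfold rootReflection
  rw [Submodule.reflection_orthogonal_apply, Submodule.reflection_singleton_apply,
    real_inner_self_eq_norm_sq, real_inner_comm]
  simp only [neg_sub, RCLike.ofReal_real_eq_id, id_eq, ← Nat.cast_smul_eq_nsmul ℝ, smul_smul]
  congr 2
  push_cast
  ring

/-- An integral root system: a finite set of vectors in a finite-dimensional real inner product
space (not assumed to span it) subject to the four axioms below. Axiom `reduced` excludes the zero
vector. -/
structure IntegralRootSystem (V : Type*) [NormedAddCommGroup V] [InnerProductSpace ℝ V] where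
  roots : Finset V
  neg_mem : ∀ α ∈ roots, -α ∈ roots
  reduced : ∀ α ∈ roots, ∀ k : ℝ, k • α ∈ roots → k = 1 ∨ k = -1
  reflection_image : ∀ α ∈ roots, (rootReflection α) '' (roots : Set V) = (roots : Set V)
  integral : ∀ α ∈ roots, ∀ β ∈ roots, ∃ m : ℤ, 2 * ⟪α, β⟫_ℝ / ⟪α, α⟫_ℝ = m

namespace IntegralRootSystem

variable {V : Type*} [NormedAddCommGroup V] [InnerProductSpace ℝ V] (R : IntegralRootSystem V)

/-- The Weyl group, generated by the reflections in the roots. -/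
def weylGroup : Subgroup (V ≃ₗᵢ[ℝ] V) :=
  Subgroup.closure {s | ∃ α ∈ R.roots, s = rootReflection α}

theorem weylGroup_image {g : V ≃ₗᵢ[ℝ] V} (hg : g ∈ R.weylGroup) :
    g '' (R.roots : Set V) = (R.roots : Set V) := by
  induction hg using Subgroup.closure_induction with
  | mem x hx =>
    obtain ⟨α, hα, rfl⟩ := hx
    exact R.reflection_image α hα
  | one => simp
  | mul x y _ _ hx hy =>
    have : (⇑(x * y) : V → V) = x ∘ y := rfl
    rw [this, Set.image_comp, hy, hx]
  | inv x _ hx =>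
    conv_lhs => rw [← hx]
    rw [← Set.image_comp]
    have : (⇑x⁻¹ ∘ ⇑x : V → V) = id := by
      funext v
      exact x.symm_apply_apply v
    rw [this, Set.image_id]

theorem weylGroup_fix {g : V ≃ₗᵢ[ℝ] V} (hg : g ∈ R.weylGroup) :
    ∀ x : V, (∀ α ∈ R.roots, ⟪x, α⟫_ℝ = 0) → g x = x := by
  induction hg using Subgroup.closure_induction with
  | mem g hg =>
    obtain ⟨α, hα, rfl⟩ := hg
    intro x hx
    rw [rootReflection_apply, hx α hα]
    simp
  | one => intro x _; rfl
  | mul a b _ _ ha hb =>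
    intro x hx
    change a (b x) = x
    rw [hb x hx, ha x hx]
  | inv a _ ha =>
    intro x hx
    change a.symm x = x
    rw [LinearIsometryEquiv.symm_apply_eq, ha x hx]

instance finite_weylGroup : Finite R.weylGroup := by
  let f : R.weylGroup → (R.roots → R.roots) := fun g α =>
    ⟨g.1 α.1, by
      have h := R.weylGroup_image g.2
      have h' : g.1 α.1 ∈ g.1 '' (R.roots : Set V) := ⟨α.1, α.2, rfl⟩
      rw [h] at h'
      exact h'⟩
  refine Finite.of_injective f ?_
  intro g h hgh
  have hroot : ∀ α ∈ R.roots, g.1 α = h.1 α := fun α hα =>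
    congrArg Subtype.val (congrFun hgh ⟨α, hα⟩)
  have hspan : ∀ x ∈ Submodule.span ℝ (R.roots : Set V), g.1 x = h.1 x := by
    intro x hx
    induction hx using Submodule.span_induction with
    | mem x hx => exact hroot x hx
    | zero => simp
    | add x y _ _ hx hy => simp [hx, hy]
    | smul c x _ hx => simp [hx]
  apply Subtype.ext
  ext x
  have : FiniteDimensional ℝ (Submodule.span ℝ (R.roots : Set V)) :=
    FiniteDimensional.span_finset ℝ R.roots
  obtain ⟨y, hy, z, hz, rfl⟩ :=
    (Submodule.span ℝ (R.roots : Set V)).exists_add_mem_mem_orthogonal x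
  have hz' : ∀ α ∈ R.roots, ⟪z, α⟫_ℝ = 0 := fun α hα => by
    rw [real_inner_comm]
    exact (Submodule.mem_orthogonal _ _).1 hz α (Submodule.subset_span hα)
  rw [map_add, map_add, hspan y hy, R.weylGroup_fix g.2 z hz', R.weylGroup_fix h.2 z hz']

instance fintypeWeylGroup : Fintype R.weylGroup := Fintype.ofFinite _

/-- `a₁, …, a_r` is a system of simple roots: linearly independent roots such that every root is an
integer combination of them with coefficients all `≥ 0` or all `≤ 0`. -/
structure IsSimpleSystem {r : ℕ} (a : Fin r → V) : Prop where
  mem_roots : ∀ i, a i ∈ R.roots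
  linearIndependent : LinearIndependent ℝ a
  nonneg_or_nonpos : ∀ α ∈ R.roots, ∃ c : Fin r → ℕ,
    α = ∑ i, (c i : ℝ) • a i ∨ α = -∑ i, (c i : ℝ) • a i

open Classical in
/-- The set `P` of positive roots attached to a system of simple roots. -/
def positiveRoots {r : ℕ} (a : Fin r → V) : Finset V :=
  R.roots.filter fun α => ∃ c : Fin r → ℕ, α = ∑ i, (c i : ℝ) • a i

/-- The half-sum `ρ` of the positive roots. -/
def rho {r : ℕ} (a : Fin r → V) : V := (1 / 2 : ℝ) • ∑ α ∈ R.positiveRoots a, α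

/-- The alternating sum `∑_{s ∈ W} det(s) e^{i⟨s ν, H⟩}`. -/
def alternatingSum (ν H : V) : ℂ :=
  ∑ s : R.weylGroup,
    ((LinearMap.det (s.1.toLinearEquiv : V →ₗ[ℝ] V) : ℝ) : ℂ) *
      Complex.exp (Complex.I * ((⟪s.1 ν, H⟫_ℝ : ℝ) : ℂ))

/-- The Weyl denominator in product form, `e^{-i⟨ρ, H⟩} ∏_{α ∈ P} (e^{i⟨α, H⟩} - 1)`. -/
def denominatorProduct {r : ℕ} (a : Fin r → V) (H : V) : ℂ :=
  Complex.exp (-(Complex.I * ((⟪R.rho a, H⟫_ℝ : ℝ) : ℂ))) *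
    ∏ α ∈ R.positiveRoots a, (Complex.exp (Complex.I * ((⟪α, H⟫_ℝ : ℝ) : ℂ)) - 1)

/-- The Weyl character `χ_ν(H)`: the quotient
`∑ det(s) e^{i⟨sν, H⟩} / ∑ det(s) e^{i⟨sρ, H⟩}` where the denominator does not vanish, extended by
continuity (as a limit) to the chamber walls, where the quotient reads `0 / 0`. -/
def weylCharacter {r : ℕ} (a : Fin r → V) (ν : V) : V → ℂ :=
  extendFrom {H | R.alternatingSum (R.rho a) H ≠ 0}
    fun H => R.alternatingSum ν H / R.alternatingSum (R.rho a) H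

end IntegralRootSystem

/-- The weight lattice attached to the simple roots `a₁, …, a_r`: the vectors `μ` of their real span
with `2⟨μ, a_j⟩ / ⟨a_j, a_j⟩ ∈ ℤ` for all `j`. By `weightLattice_eq_closure` it is the lattice
`ℤ w₁ + ⋯ + ℤ w_r` generated by the fundamental weights. -/
def weightLattice {V : Type*} [NormedAddCommGroup V] [InnerProductSpace ℝ V] {r : ℕ}
    (a : Fin r → V) : AddSubgroup V where
  carrier := {μ | μ ∈ Submodule.span ℝ (Set.range a) ∧
    ∀ j, ∃ m : ℤ, 2 * ⟪μ, a j⟫_ℝ / ⟪a j, a j⟫_ℝ = m}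
  zero_mem' := ⟨Submodule.zero_mem _, fun _ => ⟨0, by simp⟩⟩
  add_mem' := by
    rintro x y ⟨hx, hx'⟩ ⟨hy, hy'⟩
    refine ⟨Submodule.add_mem _ hx hy, fun j => ?_⟩
    obtain ⟨m, hm⟩ := hx' j
    obtain ⟨n, hn⟩ := hy' j
    refine ⟨m + n, ?_⟩
    push_cast
    rw [← hm, ← hn, inner_add_left]
    ring
  neg_mem' := by
    rintro x ⟨hx, hx'⟩
    refine ⟨Submodule.neg_mem _ hx, fun j => ?_⟩
    obtain ⟨m, hm⟩ := hx' j
    refine ⟨-m, ?_⟩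
    push_cast
    rw [← hm, inner_neg_left]
    ring

/-- If `w₁, …, w_r` is the basis of the span of the simple roots dual to the simple coroots
`2 a_j / ⟨a_j, a_j⟩`, then the weight lattice is `ℤ w₁ + ⋯ + ℤ w_r`. -/
theorem weightLattice_eq_closure {V : Type*} [NormedAddCommGroup V] [InnerProductSpace ℝ V] {r : ℕ}
    (a w : Fin r → V) (ha : LinearIndependent ℝ a)
    (hw : ∀ i, w i ∈ Submodule.span ℝ (Set.range a))
    (hdual : ∀ i j, 2 * ⟪w i, a j⟫_ℝ / ⟪a j, a j⟫_ℝ = if i = j then 1 else 0) :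
    weightLattice a = AddSubgroup.closure (Set.range w) := by
  apply le_antisymm
  · rintro μ ⟨hμ, hμ'⟩
    choose m hm using hμ'
    have key : μ = ∑ i, m i • w i := by
      have hmem : μ - ∑ i, m i • w i ∈ Submodule.span ℝ (Set.range a) :=
        Submodule.sub_mem _ hμ (Submodule.sum_mem _ fun i _ =>
          zsmul_mem (hw i) (m i))
      have horth : ∀ j, ⟪μ - ∑ i, m i • w i, a j⟫_ℝ = 0 := by
        intro j
        have hne : ⟪a j, a j⟫_ℝ ≠ 0 := inner_self_ne_zero.2 (ha.ne_zero j)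
        have h1 : 2 * ⟪μ - ∑ i, m i • w i, a j⟫_ℝ / ⟪a j, a j⟫_ℝ = 0 := by
          rw [inner_sub_left, sum_inner, mul_sub, sub_div, hm j, Finset.mul_sum, Finset.sum_div]
          have : ∀ i, 2 * ⟪m i • w i, a j⟫_ℝ / ⟪a j, a j⟫_ℝ = if i = j then (m i : ℝ) else 0 := by
            intro i
            rw [← Int.cast_smul_eq_zsmul ℝ, real_inner_smul_left,
              show 2 * ((m i : ℝ) * ⟪w i, a j⟫_ℝ) / ⟪a j, a j⟫_ℝ =
                (m i : ℝ) * (2 * ⟪w i, a j⟫_ℝ / ⟪a j, a j⟫_ℝ) by ring, hdual i j]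
            simp
          rw [Finset.sum_congr rfl fun i _ => this i]
          simp
        have h2 := (div_eq_zero_iff.1 h1).resolve_right hne
        linarith
      have hall : ∀ y ∈ Submodule.span ℝ (Set.range a), ⟪μ - ∑ i, m i • w i, y⟫_ℝ = 0 := by
        intro y hy
        induction hy using Submodule.span_induction with
        | mem y hy => obtain ⟨j, rfl⟩ := hy; exact horth j
        | zero => simp
        | add x y _ _ hx hy => rw [inner_add_right, hx, hy, add_zero]
        | smul c x _ hx => rw [real_inner_smul_right, hx, mul_zero]
      exact sub_eq_zero.1 (inner_self_eq_zero.1 (hall _ hmem))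
    rw [key]
    exact AddSubgroup.sum_mem _ fun i _ =>
      AddSubgroup.zsmul_mem _ (AddSubgroup.subset_closure (Set.mem_range_self i)) _
  · rw [AddSubgroup.closure_le]
    rintro _ ⟨i, rfl⟩
    refine ⟨hw i, fun j => ⟨if i = j then 1 else 0, ?_⟩⟩
    rw [hdual i j]
    split_ifs <;> simp

/-- The iterated difference `D_{i₁} ⋯ D_{i_k} f` for the list `[i₁, …, i_k]`, where
`D_i f (n) = f (n + e_i) - f (n)`. -/
def iteratedDifference {r : ℕ} : List (Fin r) → ((Fin r → ℤ) → ℂ) → ((Fin r → ℤ) → ℂ)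
  | [], f => f
  | i :: l, f => fwdDiff (Pi.single i (1 : ℤ)) (iteratedDifference l f)

end

/-! Write `J_ν = ∑ det(s) e^{sν}` in the group algebra of `V`. Modulo `e^α - 1` the terms of `s`
and `s_α s` cancel, so `e^α - 1` divides `J_ν`; distinct positive roots being non-proportional,
so does the product of all `e^α - 1`. For `ν = ρ` both sides occupy the same range of heights,
and only the identity of the Weyl group preserves the height of `ρ`: comparing the extreme
heights gives the denominator formula. Hence the character `J_ν / J_ρ` is itself an exponential
sum, defined on every complex line `H + zδ`.

On such a line `J_ρ` times an iterated difference of the character is the sum over `s` of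
`det(s) e^{s(λ + μ)} ∏_j (e^{s a_{i_j}} - 1)`. Take for `δ` the vector representing the height,
which pairs to at least `1` with every positive root. On a circle `|z| ≍ 1 / N` every factor
`e^β - 1` has size `≍ 1 / N`, while the exponentials stay bounded because `λ` has size `O(N)`.
So the differences are `O(N^{|P| - k})` on the circle, and at `z = 0` by the maximum principle.
For bounded `N` only finitely many `n` occur, and exponential sums are bounded. -/

noncomputable section

/-! ### Divisibility in group algebras -/

section GroupAlgebra

open AddMonoidAlgebra
open scoped nonZeroDivisors

variable {k A : Type*} [CommRing k] [AddCommGroup A]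

theorem coeff_single_sub_one_mul (x y : A) (G : AddMonoidAlgebra k A) :
    ((single x 1 - 1) * G).coeff y = G.coeff (y - x) - G.coeff y := by
  have hshift : (single x 1 * G).coeff y = G.coeff (y - x) := by
    simpa using coeff_single_mul_add (r := (1 : k)) (m := x) (x := G) (m' := y - x)
  rw [sub_mul, one_mul, coeff_sub, Finsupp.sub_apply, hshift]

theorem single_sub_one_mem_nonZeroDivisors {x : A} (hx : ∀ m : ℤ, m • x = 0 → m = 0) :
    (single x 1 - 1 : AddMonoidAlgebra k A) ∈ (AddMonoidAlgebra k A)⁰ := by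
  refine mem_nonZeroDivisors_iff_left.2 fun G hG => ?_
  have hstep (y : A) : G.coeff (y - x) = G.coeff y := by
    rw [← sub_eq_zero, ← coeff_single_sub_one_mul, hG, coeff_zero, Finsupp.zero_apply]
  have hperiodic (y : A) (n : ℕ) : G.coeff (y + n • x) = G.coeff y := by
    induction n with
    | zero => rw [zero_smul, add_zero]
    | succ n ih =>
      rw [← ih, ← hstep (y + (n + 1) • x), succ_nsmul, ← add_assoc, add_sub_cancel_right]
  have hinj (y : A) : Function.Injective fun n : ℕ => y + n • x := fun m n hmn => by
    have := hx (m - n) (by simpa [sub_smul, sub_eq_zero] using hmn)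
    omega
  ext y
  by_contra hy
  exact Set.infinite_of_injective_forall_mem (hinj y)
    (fun n => by simpa [hperiodic y n] using hy) G.coeff.support.finite_toSet

/-- Reduction of exponents modulo `ℤ x`: algebraically, the restriction of exponential sums to the
subgroup `e^x = 1`. -/
def reduceModZMultiples (k : Type*) [CommRing k] (x : A) :
    AddMonoidAlgebra k A →+* AddMonoidAlgebra k (A ⧸ AddSubgroup.zmultiples x) :=
  mapDomainRingHom k (QuotientAddGroup.mk' (AddSubgroup.zmultiples x))

theorem reduceModZMultiples_single (x y : A) (c : k) :
    reduceModZMultiples k x (single y c) = single (y : A ⧸ AddSubgroup.zmultiples x) c := by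
  simp [reduceModZMultiples]

theorem single_sub_one_dvd_single_zsmul_sub_one (x : A) (m : ℤ) :
    (single x 1 - 1 : AddMonoidAlgebra k A) ∣ single (m • x) 1 - 1 := by
  have hnat (n : ℕ) : (single x 1 - 1 : AddMonoidAlgebra k A) ∣ single (n • x) 1 - 1 := by
    simpa only [single_pow, one_pow] using
      sub_one_dvd_pow_sub_one (single x 1 : AddMonoidAlgebra k A) n
  obtain ⟨n, rfl | rfl⟩ := m.eq_nat_or_neg
  · simpa using hnat n
  · have hneg : (single (-(n : ℤ) • x) 1 - 1 : AddMonoidAlgebra k A) =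
        -single (-(n : ℤ) • x) 1 * (single (n • x) 1 - 1) := by
      rw [mul_sub, neg_mul, single_mul_single]
      simp [one_def, neg_add_eq_sub]
    exact hneg ▸ (hnat n).mul_left _

theorem single_sub_one_dvd_single_sub_single {x y z : A}
    (h : (y : A ⧸ AddSubgroup.zmultiples x) = z) (c : k) :
    (single x 1 - 1 : AddMonoidAlgebra k A) ∣ single y c - single z c := by
  obtain ⟨m, hm⟩ := AddSubgroup.mem_zmultiples_iff.1 (QuotientAddGroup.eq.1 h)
  have hfactor : (single y c - single z c : AddMonoidAlgebra k A) =
      -single y c * (single (m • x) 1 - 1) := by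
    rw [hm, mul_sub, neg_mul, single_mul_single]
    simp [neg_add_eq_sub]
  exact hfactor ▸ (single_sub_one_dvd_single_zsmul_sub_one x m).mul_left _

theorem single_sub_one_dvd_of_reduceModZMultiples_eq_zero {x : A} {G : AddMonoidAlgebra k A}
    (h : reduceModZMultiples k x G = 0) : (single x 1 - 1) ∣ G := by
  have hsection (F : AddMonoidAlgebra k A) : (single x 1 - 1) ∣
      F - mapDomain (fun q : A ⧸ AddSubgroup.zmultiples x => q.out)
        (reduceModZMultiples k x F) := by
    induction F using AddMonoidAlgebra.induction_linear with
    | zero => simp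
    | add f g hf hg =>
      rw [map_add, mapDomain_add, add_sub_add_comm]
      exact dvd_add hf hg
    | single y c =>
      rw [reduceModZMultiples_single, mapDomain_single]
      exact single_sub_one_dvd_single_sub_single (QuotientAddGroup.out_eq' _).symm c
  simpa only [h, mapDomain_zero, sub_zero] using hsection G

/-- For pairwise independent `x`, the factors `e^x - 1` are coprime in the sense that each is
a non-zero-divisor modulo any other. -/
theorem prod_single_sub_one_dvd (S : Finset A)
    (hS : ∀ x ∈ S, ∀ y ∈ S, x ≠ y → ∀ m n : ℤ, m • x = n • y → m = 0)
    {F : AddMonoidAlgebra k A} (hF : ∀ x ∈ S, reduceModZMultiples k x F = 0) :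
    (∏ x ∈ S, (single x 1 - 1)) ∣ F := by
  classical
  induction S using Finset.induction_on with
  | empty => simp
  | insert x S hx ih =>
    simp only [Finset.forall_mem_insert] at hS hF
    obtain ⟨G, rfl⟩ := ih (fun y hy => (hS.2 y hy).2) hF.2
    have hregular : reduceModZMultiples k x (∏ y ∈ S, (single y 1 - 1)) ∈
        (AddMonoidAlgebra k (A ⧸ AddSubgroup.zmultiples x))⁰ := by
      rw [map_prod]
      refine Submonoid.prod_mem _ fun y hy => ?_
      rw [map_sub, map_one, reduceModZMultiples_single]
      refine single_sub_one_mem_nonZeroDivisors fun m hm => ?_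
      rw [← QuotientAddGroup.mk_zsmul, QuotientAddGroup.eq_zero_iff] at hm
      obtain ⟨n, hn⟩ := AddSubgroup.mem_zmultiples_iff.1 hm
      exact (hS.2 y hy).1 (fun h => hx (h ▸ hy)) m n hn.symm
    have hG : reduceModZMultiples k x G = 0 :=
      mem_nonZeroDivisors_iff_left.1 hregular _ (by rw [← map_mul, hF.1])
    rw [Finset.prod_insert hx, mul_comm]
    exact mul_dvd_mul_left _ (single_sub_one_dvd_of_reduceModZMultiples_eq_zero hG)

section Heights

variable {Γ : Type*} [AddCommGroup Γ] [LinearOrder Γ] [IsOrderedAddMonoid Γ]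

theorem height_mem_Icc_of_single_sub_one_mul (ht : A →+ Γ) {x : A} (hx : 0 < ht x)
    {G : AddMonoidAlgebra k A} {b t : Γ}
    (h : ∀ y, ((single x 1 - 1) * G).coeff y ≠ 0 → ht y ∈ Set.Icc b t) (y : A)
    (hy : G.coeff y ≠ 0) : ht y ∈ Set.Icc b (t - ht x) := by
  have hne : G.coeff.support.Nonempty := ⟨y, Finsupp.mem_support_iff.2 hy⟩
  obtain ⟨u, hu, humax⟩ := Finset.exists_max_image _ ht hne
  obtain ⟨l, hl, hlmin⟩ := Finset.exists_min_image _ ht hne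
  simp only [Finsupp.mem_support_iff] at hu humax hl hlmin
  have hbelow : G.coeff (l - x) = 0 := by
    by_contra hc
    exact absurd (hlmin _ hc) (by simpa using hx)
  have habove : G.coeff (u + x) = 0 := by
    by_contra hc
    exact absurd (humax _ hc) (by simpa using hx)
  have hbot := h l (by simpa [coeff_single_sub_one_mul, hbelow] using hl)
  have htop := h (u + x) (by simpa [coeff_single_sub_one_mul, habove] using hu)
  rw [map_add] at htop
  exact ⟨hbot.1.trans (hlmin y hy), (humax y hy).trans (le_sub_iff_add_le.2 htop.2)⟩

theorem coeff_single_sub_one_mul_add_of_height_eq (ht : A →+ Γ) {x : A} (hx : 0 < ht x)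
    {G : AddMonoidAlgebra k A} {b t : Γ}
    (h : ∀ y, G.coeff y ≠ 0 → ht y ∈ Set.Icc b t) {y : A} (hy : ht y = t) :
    ((single x 1 - 1) * G).coeff (y + x) = G.coeff y := by
  have habove : G.coeff (y + x) = 0 := by
    by_contra hc
    have := (h _ hc).2
    rw [map_add, hy] at this
    exact absurd this (by simpa using hx)
  rw [coeff_single_sub_one_mul, add_sub_cancel_right, habove, sub_zero]

theorem height_mem_Icc_of_prod_single_sub_one_mul (ht : A →+ Γ) (S : Finset A)
    (hS : ∀ x ∈ S, 0 < ht x) {G : AddMonoidAlgebra k A} {b t : Γ}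
    (h : ∀ y, ((∏ x ∈ S, (single x 1 - 1)) * G).coeff y ≠ 0 → ht y ∈ Set.Icc b t) :
    ∀ y, G.coeff y ≠ 0 → ht y ∈ Set.Icc b (t - ∑ x ∈ S, ht x) := by
  classical
  induction S using Finset.induction_on generalizing G with
  | empty => simpa using h
  | insert x S hx ih =>
    simp only [Finset.forall_mem_insert] at hS
    rw [Finset.prod_insert hx, mul_comm (single x 1 - 1), mul_assoc] at h
    rw [Finset.sum_insert hx, add_comm, ← sub_sub]
    exact height_mem_Icc_of_single_sub_one_mul ht hS.1 (ih hS.2 h)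

theorem coeff_prod_single_sub_one_mul_add_sum_of_height_eq (ht : A →+ Γ) (S : Finset A)
    (hS : ∀ x ∈ S, 0 < ht x) {G : AddMonoidAlgebra k A} {b t : Γ}
    (h : ∀ y, ((∏ x ∈ S, (single x 1 - 1)) * G).coeff y ≠ 0 → ht y ∈ Set.Icc b t) {y : A}
    (hy : ht y = t - ∑ x ∈ S, ht x) :
    ((∏ x ∈ S, (single x 1 - 1)) * G).coeff (y + ∑ x ∈ S, x) = G.coeff y := by
  classical
  induction S using Finset.induction_on generalizing G y with
  | empty => simp
  | insert x S hx ih =>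
    have hG := height_mem_Icc_of_prod_single_sub_one_mul ht _ hS h
    simp only [Finset.forall_mem_insert] at hS
    rw [Finset.prod_insert hx, mul_comm (single x 1 - 1), mul_assoc] at h ⊢
    rw [Finset.sum_insert hx, ← add_assoc, ih hS.2 h]
    · exact coeff_single_sub_one_mul_add_of_height_eq ht hS.1 hG hy
    · rw [map_add, hy, Finset.sum_insert hx]
      abel

end Heights

/-- Evaluation of a formal exponential sum at an additive functional: `e^v ↦ exp (φ v)`. -/
def expEval (φ : A →+ ℂ) : AddMonoidAlgebra ℂ A →ₐ[ℂ] ℂ :=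
  lift ℂ ℂ A
    { toFun := fun v => Complex.exp (φ v.toAdd)
      map_one' := by simp
      map_mul' := fun v w => by simp [Complex.exp_add] }

theorem expEval_single (φ : A →+ ℂ) (v : A) (c : ℂ) :
    expEval φ (single v c) = c * Complex.exp (φ v) := by
  simp [expEval]

end GroupAlgebra

/-! ### Root systems -/

section Reflection

variable {V : Type*} [NormedAddCommGroup V] [InnerProductSpace ℝ V]

theorem rootReflection_neg (α : V) : rootReflection (-α) = rootReflection α := by
  ext x
  simp [rootReflection_apply, neg_div, sub_eq_add_neg]

theorem rootReflection_conj (g : V ≃ₗᵢ[ℝ] V) (α : V) :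
    rootReflection (g α) = g * rootReflection α * g⁻¹ := by
  ext x
  change _ = g (rootReflection α (g.symm x))
  have hinner : ⟪x, g α⟫_ℝ = ⟪g.symm x, α⟫_ℝ := by
    rw [← g.inner_map_map (g.symm x) α, g.apply_symm_apply]
  rw [rootReflection_apply, rootReflection_apply, map_sub, map_smul, g.apply_symm_apply,
    g.inner_map_map, hinner]

theorem rootReflection_mul_self (α : V) : rootReflection α * rootReflection α = 1 :=
  Submodule.reflection_mul_reflection _

theorem rootReflection_rootReflection (α x : V) :
    rootReflection α (rootReflection α x) = x :=
  Submodule.reflection_reflection _ x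

theorem rootReflection_apply_self (α : V) : rootReflection α α = -α :=
  Submodule.reflection_orthogonalComplement_singleton_eq_neg α

theorem det_rootReflection [FiniteDimensional ℝ V] {α : V} (hα : α ≠ 0) :
    LinearMap.det ((rootReflection α).toLinearEquiv : V →ₗ[ℝ] V) = -1 := by
  have h := Submodule.det_reflection (ℝ ∙ α)ᗮ
  rwa [Submodule.orthogonal_orthogonal, finrank_span_singleton hα, pow_one] at h

end Reflection

section IntegralWeights

variable {V : Type*} [NormedAddCommGroup V] [InnerProductSpace ℝ V] {r : ℕ}

/-- The vectors whose pairings with the simple coroots `2 a_j / ⟨a_j, a_j⟩` are integers. Unlike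
the elements of `weightLattice a`, they need not lie in the span of the `a_j`. -/
def integralWeights (a : Fin r → V) : AddSubgroup V where
  carrier := {ν | ∀ j, ∃ m : ℤ, 2 * ⟪ν, a j⟫_ℝ / ⟪a j, a j⟫_ℝ = m}
  zero_mem' := fun _ => ⟨0, by simp⟩
  add_mem' := by
    intro x y hx hy j
    obtain ⟨m, hm⟩ := hx j
    obtain ⟨n, hn⟩ := hy j
    exact ⟨m + n, by rw [inner_add_left, mul_add, add_div, hm, hn, Int.cast_add]⟩
  neg_mem' := by
    intro x hx j
    obtain ⟨m, hm⟩ := hx j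
    exact ⟨-m, by rw [inner_neg_left, mul_neg, neg_div, hm, Int.cast_neg]⟩

theorem weightLattice_le_integralWeights (a : Fin r → V) :
    weightLattice a ≤ integralWeights a :=
  fun _ hμ => hμ.2

end IntegralWeights

namespace IntegralRootSystem

variable {V : Type*} [NormedAddCommGroup V] [InnerProductSpace ℝ V] (R : IntegralRootSystem V)

theorem ne_zero_of_mem {α : V} (hα : α ∈ R.roots) : α ≠ 0 := by
  rintro rfl
  have := R.reduced 0 hα 2 (by simpa using hα)
  norm_num at this

theorem apply_mem_roots {g : V ≃ₗᵢ[ℝ] V} (hg : g ∈ R.weylGroup) {α : V} (hα : α ∈ R.roots) :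
    g α ∈ R.roots :=
  Finset.mem_coe.1 (R.weylGroup_image hg ▸ Set.mem_image_of_mem g (Finset.mem_coe.2 hα))

theorem sum_roots_apply {M : Type*} [AddCommMonoid M] (f : V → M) {g : V ≃ₗᵢ[ℝ] V}
    (hg : g ∈ R.weylGroup) : ∑ α ∈ R.roots, f (g α) = ∑ α ∈ R.roots, f α :=
  Finset.sum_bij' (fun α _ => g α) (fun α _ => g.symm α)
    (fun _ hα => R.apply_mem_roots hg hα) (fun _ hα => R.apply_mem_roots (inv_mem hg) hα)
    (fun α _ => g.symm_apply_apply α) (fun α _ => g.apply_symm_apply α) (fun _ _ => rfl)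

theorem rootReflection_mem_weylGroup {α : V} (hα : α ∈ R.roots) :
    rootReflection α ∈ R.weylGroup :=
  Subgroup.subset_closure ⟨α, hα, rfl⟩

theorem mem_positiveRoots {r : ℕ} {a : Fin r → V} {α : V} :
    α ∈ R.positiveRoots a ↔ α ∈ R.roots ∧ ∃ c : Fin r → ℕ, α = ∑ i, (c i : ℝ) • a i := by
  classical
  simp [positiveRoots]

theorem mem_roots_of_mem_positiveRoots {r : ℕ} {a : Fin r → V} {α : V}
    (hα : α ∈ R.positiveRoots a) : α ∈ R.roots :=
  (R.mem_positiveRoots.1 hα).1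

theorem rho_add_rho {r : ℕ} (a : Fin r → V) :
    R.rho a + R.rho a = ∑ α ∈ R.positiveRoots a, α := by
  rw [rho]
  module

/-- The product `s_{i₁} ⋯ s_{i_m}` of the simple reflections indexed by a list. -/
def simpleWord {r : ℕ} (a : Fin r → V) (L : List (Fin r)) : V ≃ₗᵢ[ℝ] V :=
  (L.map fun i => rootReflection (a i)).prod

section SimpleWord

variable {r : ℕ} (a : Fin r → V)

theorem simpleWord_nil : simpleWord a [] = 1 := rfl

theorem simpleWord_cons (i : Fin r) (L : List (Fin r)) :
    simpleWord a (i :: L) = rootReflection (a i) * simpleWord a L := by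
  simp [simpleWord]

theorem simpleWord_cons_apply (i : Fin r) (L : List (Fin r)) (x : V) :
    simpleWord a (i :: L) x = rootReflection (a i) (simpleWord a L x) := by
  rw [simpleWord_cons, LinearIsometryEquiv.coe_mul, Function.comp_apply]

theorem simpleWord_append (L M : List (Fin r)) :
    simpleWord a (L ++ M) = simpleWord a L * simpleWord a M := by
  simp [simpleWord]

theorem simpleWord_concat (L : List (Fin r)) (i : Fin r) :
    simpleWord a (L.concat i) = simpleWord a L * rootReflection (a i) := by
  simp [simpleWord]

theorem simpleWord_reverse (L : List (Fin r)) :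
    simpleWord a L.reverse = (simpleWord a L)⁻¹ := by
  induction L with
  | nil => simp [simpleWord_nil]
  | cons i L ih =>
    rw [List.reverse_cons, ← List.concat_eq_append, simpleWord_concat, ih, simpleWord_cons,
      mul_inv_rev, inv_eq_of_mul_eq_one_left (rootReflection_mul_self (a i))]

end SimpleWord

namespace IsSimpleSystem

variable {R} {r : ℕ} {a : Fin r → V}

theorem simple_ne_zero (ha : R.IsSimpleSystem a) (i : Fin r) : a i ≠ 0 :=
  R.ne_zero_of_mem (ha.mem_roots i)

theorem exists_coord (ha : R.IsSimpleSystem a) :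
    ∃ co : V →ₗ[ℝ] (Fin r → ℝ), ∀ c : Fin r → ℝ, co (∑ i, c i • a i) = c := by
  obtain ⟨co, hco⟩ := (Fintype.linearCombination ℝ a).exists_leftInverse_of_injective
    (LinearMap.ker_eq_bot.2
      (linearIndependent_iff_injective_fintypeLinearCombination.1 ha.linearIndependent))
  exact ⟨co, fun c => by simpa [Fintype.linearCombination_apply] using LinearMap.congr_fun hco c⟩

/-- Coordinates with respect to a system of simple roots. Outside the span of the simple roots
their values are those of an arbitrary linear extension. -/
def coord (ha : R.IsSimpleSystem a) : V →ₗ[ℝ] (Fin r → ℝ) := ha.exists_coord.choose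

theorem coord_sum (ha : R.IsSimpleSystem a) (c : Fin r → ℝ) : ha.coord (∑ i, c i • a i) = c :=
  ha.exists_coord.choose_spec c

theorem coord_simple (ha : R.IsSimpleSystem a) (i : Fin r) :
    ha.coord (a i) = Pi.single i 1 := by
  simpa [Pi.single_apply] using ha.coord_sum (Pi.single i 1)

theorem sum_coord_smul (ha : R.IsSimpleSystem a) {α : V} (hα : α ∈ R.roots) :
    ∑ i, ha.coord α i • a i = α := by
  obtain ⟨c, rfl | rfl⟩ := ha.nonneg_or_nonpos α hα
  · rw [ha.coord_sum]
  · simp only [map_neg, ha.coord_sum, Pi.neg_apply, neg_smul, Finset.sum_neg_distrib]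

theorem coord_nonneg (ha : R.IsSimpleSystem a) {α : V} (hα : α ∈ R.positiveRoots a)
    (i : Fin r) : 0 ≤ ha.coord α i := by
  obtain ⟨-, c, rfl⟩ := R.mem_positiveRoots.1 hα
  rw [ha.coord_sum]
  positivity

theorem mem_or_neg_mem (ha : R.IsSimpleSystem a) {α : V} (hα : α ∈ R.roots) :
    α ∈ R.positiveRoots a ∨ -α ∈ R.positiveRoots a := by
  obtain ⟨c, hc | hc⟩ := ha.nonneg_or_nonpos α hα
  · exact Or.inl (R.mem_positiveRoots.2 ⟨hα, c, hc⟩)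
  · exact Or.inr (R.mem_positiveRoots.2 ⟨R.neg_mem α hα, c, by rw [hc, neg_neg]⟩)

theorem mem_positiveRoots_of_coord_pos (ha : R.IsSimpleSystem a) {α : V} (hα : α ∈ R.roots)
    {i : Fin r} (hi : 0 < ha.coord α i) : α ∈ R.positiveRoots a := by
  refine (ha.mem_or_neg_mem hα).resolve_right fun hneg => ?_
  have := ha.coord_nonneg hneg i
  rw [map_neg, Pi.neg_apply] at this
  linarith

theorem simple_mem_positiveRoots (ha : R.IsSimpleSystem a) (i : Fin r) :
    a i ∈ R.positiveRoots a :=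
  ha.mem_positiveRoots_of_coord_pos (ha.mem_roots i) (i := i) (by simp [ha.coord_simple])

/-- The height: the sum of the coordinates with respect to the simple roots. -/
def height (ha : R.IsSimpleSystem a) : V →ₗ[ℝ] ℝ :=
  (∑ i, LinearMap.proj i) ∘ₗ ha.coord

theorem height_apply (ha : R.IsSimpleSystem a) (v : V) : ha.height v = ∑ i, ha.coord v i := by
  simp [height]

theorem height_simple (ha : R.IsSimpleSystem a) (i : Fin r) : ha.height (a i) = 1 := by
  simp [height_apply, ha.coord_simple]

theorem one_le_height (ha : R.IsSimpleSystem a) {α : V} (hα : α ∈ R.positiveRoots a) :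
    1 ≤ ha.height α := by
  obtain ⟨hroot, c, rfl⟩ := R.mem_positiveRoots.1 hα
  obtain ⟨i, hi⟩ : ∃ i, c i ≠ 0 := by
    by_contra! hc
    exact R.ne_zero_of_mem hroot (by simp [hc])
  rw [ha.height_apply, ha.coord_sum]
  calc (1 : ℝ) ≤ c i := by exact_mod_cast Nat.one_le_iff_ne_zero.2 hi
    _ ≤ ∑ j, (c j : ℝ) := Finset.single_le_sum (f := fun j => (c j : ℝ))
      (fun j _ => by positivity) (Finset.mem_univ i)

theorem neg_notMem (ha : R.IsSimpleSystem a) {α : V} (hα : α ∈ R.positiveRoots a) :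
    -α ∉ R.positiveRoots a := fun hneg => by
  have hpos := ha.one_le_height hα
  have hneg := ha.one_le_height hneg
  rw [map_neg] at hneg
  linarith

theorem mem_positiveRoots_of_height_nonneg (ha : R.IsSimpleSystem a) {α : V}
    (hα : α ∈ R.roots) (h : 0 ≤ ha.height α) : α ∈ R.positiveRoots a := by
  refine (ha.mem_or_neg_mem hα).resolve_right fun hneg => ?_
  have := ha.one_le_height hneg
  rw [map_neg] at this
  linarith

theorem eq_zero_of_zsmul_eq_zsmul (ha : R.IsSimpleSystem a) {α β : V}
    (hα : α ∈ R.positiveRoots a) (hβ : β ∈ R.positiveRoots a) (hne : α ≠ β) (m n : ℤ)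
    (h : m • α = n • β) : m = 0 := by
  by_contra hm
  have hm' : (m : ℝ) ≠ 0 := by exact_mod_cast hm
  have hαβ : α = ((n : ℝ) / m) • β := by
    rw [← Int.cast_smul_eq_zsmul ℝ, ← Int.cast_smul_eq_zsmul ℝ] at h
    rw [div_eq_inv_mul, mul_smul, ← h, smul_smul, inv_mul_cancel₀ hm', one_smul]
  rcases R.reduced β (R.mem_roots_of_mem_positiveRoots hβ) _
    (hαβ ▸ R.mem_roots_of_mem_positiveRoots hα) with hone | hneg
  · exact hne (by rw [hαβ, hone, one_smul])
  · rw [hneg, neg_one_smul] at hαβ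
    exact ha.neg_notMem hβ (hαβ ▸ hα)

theorem sum_roots_of_even (ha : R.IsSimpleSystem a) {M : Type*} [AddCommMonoid M] {f : V → M}
    (hf : ∀ x, f (-x) = f x) :
    ∑ α ∈ R.roots, f α = 2 • ∑ α ∈ R.positiveRoots a, f α := by
  classical
  have hroots : R.roots = R.positiveRoots a ∪ (R.positiveRoots a).image Neg.neg := by
    ext α
    simp only [Finset.mem_union, Finset.mem_image]
    constructor
    · exact fun h => (ha.mem_or_neg_mem h).imp_right fun hneg => ⟨-α, hneg, neg_neg α⟩
    · rintro (h | ⟨β, h, rfl⟩)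
      · exact R.mem_roots_of_mem_positiveRoots h
      · exact R.neg_mem _ (R.mem_roots_of_mem_positiveRoots h)
  have hdisj : Disjoint (R.positiveRoots a) ((R.positiveRoots a).image Neg.neg) := by
    rw [Finset.disjoint_right, Finset.forall_mem_image]
    exact fun β hβ => ha.neg_notMem hβ
  rw [hroots, Finset.sum_union hdisj, Finset.sum_image neg_injective.injOn, two_nsmul]
  simp only [hf]

theorem rootReflection_simple_mem (ha : R.IsSimpleSystem a) {α : V}
    (hα : α ∈ R.positiveRoots a) {i : Fin r} (hne : α ≠ a i) :
    rootReflection (a i) α ∈ R.positiveRoots a := by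
  have hroot := R.mem_roots_of_mem_positiveRoots hα
  obtain ⟨j, hji, hj⟩ : ∃ j, j ≠ i ∧ 0 < ha.coord α j := by
    by_contra! hcon
    have hmultiple : α = ha.coord α i • a i := by
      conv_lhs => rw [← ha.sum_coord_smul hroot]
      refine Finset.sum_eq_single i (fun j _ hj => ?_) (by simp)
      rw [le_antisymm (hcon j hj) (ha.coord_nonneg hα j), zero_smul]
    rcases R.reduced (a i) (ha.mem_roots i) _ (hmultiple ▸ hroot) with hone | hneg
    · exact hne (by rw [hmultiple, hone, one_smul])
    · linarith [ha.coord_nonneg hα i]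
  refine ha.mem_positiveRoots_of_coord_pos (i := j)
    (R.apply_mem_roots (R.rootReflection_mem_weylGroup (ha.mem_roots i)) hroot) ?_
  rw [rootReflection_apply, map_sub, map_smul, ha.coord_simple]
  simpa [hji] using hj

theorem exists_inner_simple_pos (ha : R.IsSimpleSystem a) {α : V}
    (hα : α ∈ R.positiveRoots a) : ∃ i, 0 < ⟪α, a i⟫_ℝ := by
  by_contra! hcon
  have hroot := R.mem_roots_of_mem_positiveRoots hα
  have hnonpos : ⟪α, α⟫_ℝ ≤ 0 :=
    calc ⟪α, α⟫_ℝ = ∑ i, ha.coord α i * ⟪α, a i⟫_ℝ := by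
          conv_lhs => rw [← ha.sum_coord_smul hroot, inner_sum, ha.sum_coord_smul hroot]
          simp only [real_inner_smul_right]
      _ ≤ 0 := Finset.sum_nonpos fun i _ =>
          mul_nonpos_of_nonneg_of_nonpos (ha.coord_nonneg hα i) (hcon i)
  exact R.ne_zero_of_mem hroot (real_inner_self_nonpos.1 hnonpos)

theorem height_rootReflection_le (ha : R.IsSimpleSystem a) {α : V} (hα : α ∈ R.roots)
    {i : Fin r} (hi : 0 < ⟪α, a i⟫_ℝ) :
    ha.height (rootReflection (a i) α) ≤ ha.height α - 1 := by
  obtain ⟨m, hm⟩ := R.integral (a i) (ha.mem_roots i) α hα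
  rw [real_inner_comm] at hm
  have hself : 0 < ⟪a i, a i⟫_ℝ := real_inner_self_pos.2 (ha.simple_ne_zero i)
  have hm_pos : (0 : ℝ) < m := hm ▸ by positivity
  have hm_one : (1 : ℝ) ≤ m := by exact_mod_cast hm_pos
  rw [rootReflection_apply, hm, map_sub, map_smul, ha.height_simple, smul_eq_mul, mul_one]
  linarith

theorem exists_simpleWord_apply_eq (ha : R.IsSimpleSystem a) {α : V}
    (hα : α ∈ R.positiveRoots a) : ∃ L i, α = simpleWord a L (a i) := by
  obtain ⟨n, hn⟩ := exists_nat_ge (ha.height α)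
  induction n generalizing α with
  | zero =>
    rw [Nat.cast_zero] at hn
    linarith [ha.one_le_height hα]
  | succ n ih =>
    obtain ⟨i, hi⟩ := ha.exists_inner_simple_pos hα
    by_cases hne : α = a i
    · exact ⟨[], i, hne⟩
    have hlower := ha.height_rootReflection_le (R.mem_roots_of_mem_positiveRoots hα) hi
    obtain ⟨L, j, hL⟩ := ih (ha.rootReflection_simple_mem hα hne) (by
      rw [Nat.cast_succ] at hn
      linarith)
    exact ⟨i :: L, j, by rw [simpleWord_cons_apply, ← hL, rootReflection_rootReflection]⟩

theorem exists_rootReflection_eq_simpleWord (ha : R.IsSimpleSystem a) {α : V}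
    (hα : α ∈ R.roots) : ∃ L, rootReflection α = simpleWord a L := by
  wlog hpos : α ∈ R.positiveRoots a generalizing α
  · rw [← rootReflection_neg]
    exact this (R.neg_mem α hα) ((ha.mem_or_neg_mem hα).resolve_left hpos)
  obtain ⟨L, i, rfl⟩ := ha.exists_simpleWord_apply_eq hpos
  refine ⟨L ++ i :: L.reverse, ?_⟩
  rw [rootReflection_conj, simpleWord_append, simpleWord_cons, simpleWord_reverse, mul_assoc]

theorem exists_eq_simpleWord (ha : R.IsSimpleSystem a) {g : V ≃ₗᵢ[ℝ] V}
    (hg : g ∈ R.weylGroup) : ∃ L, g = simpleWord a L := by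
  induction hg using Subgroup.closure_induction with
  | mem g hg =>
    obtain ⟨α, hα, rfl⟩ := hg
    exact ha.exists_rootReflection_eq_simpleWord hα
  | one => exact ⟨[], rfl⟩
  | mul x y _ _ hx hy =>
    obtain ⟨L, rfl⟩ := hx
    obtain ⟨M, rfl⟩ := hy
    exact ⟨L ++ M, (simpleWord_append a L M).symm⟩
  | inv x _ hx =>
    obtain ⟨L, rfl⟩ := hx
    exact ⟨L.reverse, (simpleWord_reverse a L).symm⟩

/-- The exchange condition. -/
theorem exists_length_add_one_eq_and_simpleWord_eq (ha : R.IsSimpleSystem a) (L : List (Fin r))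
    (i : Fin r) (h : simpleWord a L (a i) ∉ R.positiveRoots a) :
    ∃ M : List (Fin r), M.length + 1 = L.length ∧
      simpleWord a M = simpleWord a L * rootReflection (a i) := by
  induction L with
  | nil => exact absurd (ha.simple_mem_positiveRoots i) h
  | cons j L ih =>
    by_cases hL : simpleWord a L (a i) ∈ R.positiveRoots a
    · have hj : simpleWord a L (a i) = a j := by
        by_contra hne
        exact h (simpleWord_cons_apply a j L _ ▸ ha.rootReflection_simple_mem hL hne)
      refine ⟨L, rfl, ?_⟩
      rw [simpleWord_cons, ← hj, rootReflection_conj, inv_mul_cancel_right, mul_assoc,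
        rootReflection_mul_self, mul_one]
    · obtain ⟨M, hM, hM'⟩ := ih hL
      exact ⟨j :: M, by simp [hM], by rw [simpleWord_cons, simpleWord_cons, hM', mul_assoc]⟩

theorem eq_one_of_forall_mem_positiveRoots (ha : R.IsSimpleSystem a) {g : V ≃ₗᵢ[ℝ] V}
    (hg : g ∈ R.weylGroup) (h : ∀ i, g (a i) ∈ R.positiveRoots a) : g = 1 := by
  obtain ⟨L, rfl⟩ := ha.exists_eq_simpleWord hg
  induction hn : L.length using Nat.strong_induction_on generalizing L with
  | _ n ih =>
    subst hn
    rcases List.eq_nil_or_concat L with rfl | ⟨M, i, rfl⟩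
    · rfl
    have hM : simpleWord a M (a i) ∉ R.positiveRoots a := fun hmem => by
      refine ha.neg_notMem hmem ?_
      have hi := h i
      rwa [simpleWord_concat, LinearIsometryEquiv.coe_mul, Function.comp_apply,
        rootReflection_apply_self, map_neg] at hi
    obtain ⟨M', hlen, hM'⟩ := ha.exists_length_add_one_eq_and_simpleWord_eq M i hM
    rw [simpleWord_concat, ← hM'] at hg h ⊢
    exact ih M'.length (by simp only [List.length_concat]; omega) M' hg h rfl

end IsSimpleSystem

end IntegralRootSystem

namespace IntegralRootSystem

variable {V : Type*} [NormedAddCommGroup V] [InnerProductSpace ℝ V] {R : IntegralRootSystem V}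

namespace IsSimpleSystem

variable {r : ℕ} {a : Fin r → V}

theorem simple_mem_integralWeights (ha : R.IsSimpleSystem a) (i : Fin r) :
    a i ∈ integralWeights a := fun j => by
  rw [real_inner_comm]
  exact R.integral (a j) (ha.mem_roots j) (a i) (ha.mem_roots i)

theorem simpleWord_apply_mem_integralWeights (ha : R.IsSimpleSystem a) (L : List (Fin r)) {ν : V}
    (hν : ν ∈ integralWeights a) : simpleWord a L ν ∈ integralWeights a := by
  induction L with
  | nil => exact hν
  | cons i L ih =>
    obtain ⟨m, hm⟩ := ih i
    rw [simpleWord_cons_apply, rootReflection_apply, hm, Int.cast_smul_eq_zsmul]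
    exact sub_mem ih (zsmul_mem (ha.simple_mem_integralWeights i) m)

theorem apply_mem_integralWeights (ha : R.IsSimpleSystem a) {g : V ≃ₗᵢ[ℝ] V}
    (hg : g ∈ R.weylGroup) {ν : V} (hν : ν ∈ integralWeights a) : g ν ∈ integralWeights a := by
  obtain ⟨L, rfl⟩ := ha.exists_eq_simpleWord hg
  exact ha.simpleWord_apply_mem_integralWeights L hν

theorem exists_int_of_mem_integralWeights (ha : R.IsSimpleSystem a) {ν : V}
    (hν : ν ∈ integralWeights a) {α : V} (hα : α ∈ R.roots) :
    ∃ m : ℤ, 2 * ⟪ν, α⟫_ℝ / ⟪α, α⟫_ℝ = m := by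
  wlog hpos : α ∈ R.positiveRoots a generalizing α
  · obtain ⟨m, hm⟩ := this (R.neg_mem α hα) ((ha.mem_or_neg_mem hα).resolve_left hpos)
    refine ⟨-m, ?_⟩
    rw [Int.cast_neg, ← hm, inner_neg_neg, inner_neg_right, mul_neg, neg_div, neg_neg]
  obtain ⟨L, i, rfl⟩ := ha.exists_simpleWord_apply_eq hpos
  obtain ⟨m, hm⟩ := ha.simpleWord_apply_mem_integralWeights L.reverse hν i
  refine ⟨m, ?_⟩
  have hinner : ⟪ν, simpleWord a L (a i)⟫_ℝ = ⟪(simpleWord a L).symm ν, a i⟫_ℝ := by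
    rw [← LinearIsometryEquiv.inner_map_map (simpleWord a L) _ (a i),
      LinearIsometryEquiv.apply_symm_apply]
  rw [← hm, simpleWord_reverse, LinearIsometryEquiv.inner_map_map, hinner]
  rfl

theorem rootReflection_rho (ha : R.IsSimpleSystem a) (i : Fin r) :
    rootReflection (a i) (R.rho a) = R.rho a - a i := by
  classical
  have hi := ha.simple_mem_positiveRoots i
  have hmaps : ∀ α ∈ (R.positiveRoots a).erase (a i),
      rootReflection (a i) α ∈ (R.positiveRoots a).erase (a i) := by
    intro α hα
    obtain ⟨hne, hα⟩ := Finset.mem_erase.1 hα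
    refine Finset.mem_erase.2 ⟨fun h => ?_, ha.rootReflection_simple_mem hα hne⟩
    have hα_neg : -a i = α := by
      simpa only [h, rootReflection_apply_self] using rootReflection_rootReflection (a i) α
    exact ha.neg_notMem hi (hα_neg ▸ hα)
  have hperm : ∑ α ∈ (R.positiveRoots a).erase (a i), rootReflection (a i) α =
      ∑ α ∈ (R.positiveRoots a).erase (a i), α :=
    Finset.sum_bij' (fun α _ => rootReflection (a i) α) (fun α _ => rootReflection (a i) α)
      hmaps hmaps (fun α _ => rootReflection_rootReflection _ α)
      (fun α _ => rootReflection_rootReflection _ α) (fun _ _ => rfl)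
  rw [rho, map_smul, map_sum, ← Finset.add_sum_erase _ _ hi, ← Finset.add_sum_erase _ _ hi,
    hperm, rootReflection_apply_self]
  module

theorem rho_mem_integralWeights (ha : R.IsSimpleSystem a) : R.rho a ∈ integralWeights a := by
  intro j
  have hρ := ha.rootReflection_rho j
  rw [rootReflection_apply, sub_right_inj] at hρ
  exact ⟨1, by
    rw [Int.cast_one]
    exact smul_left_injective ℝ (ha.simple_ne_zero j) (hρ.trans (one_smul ℝ (a j)).symm)⟩

theorem two_mul_height_apply_rho (ha : R.IsSimpleSystem a) (g : V ≃ₗᵢ[ℝ] V) :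
    2 * ha.height (g (R.rho a)) = ∑ α ∈ R.positiveRoots a, ha.height (g α) := by
  rw [← map_sum, ← map_sum, ← R.rho_add_rho, map_add, map_add, two_mul]

theorem sum_abs_height_apply (ha : R.IsSimpleSystem a) {g : V ≃ₗᵢ[ℝ] V}
    (hg : g ∈ R.weylGroup) :
    ∑ α ∈ R.positiveRoots a, |ha.height (g α)| = 2 * ha.height (R.rho a) := by
  have hinvariant : 2 • ∑ α ∈ R.positiveRoots a, |ha.height (g α)| =
      2 • ∑ α ∈ R.positiveRoots a, |ha.height α| := by
    rw [← ha.sum_roots_of_even (f := fun α => |ha.height (g α)|) (by simp),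
      ← ha.sum_roots_of_even (f := fun α => |ha.height α|) (by simp),
      R.sum_roots_apply (fun α => |ha.height α|) hg]
  calc ∑ α ∈ R.positiveRoots a, |ha.height (g α)|
      = ∑ α ∈ R.positiveRoots a, |ha.height α| := nsmul_right_injective two_ne_zero hinvariant
    _ = ∑ α ∈ R.positiveRoots a, ha.height α := Finset.sum_congr rfl fun α hα =>
        abs_of_nonneg (zero_le_one.trans (ha.one_le_height hα))
    _ = 2 * ha.height (R.rho a) := (ha.two_mul_height_apply_rho 1).symm

theorem abs_height_apply_rho_le (ha : R.IsSimpleSystem a) {g : V ≃ₗᵢ[ℝ] V}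
    (hg : g ∈ R.weylGroup) : |ha.height (g (R.rho a))| ≤ ha.height (R.rho a) := by
  have htriangle := Finset.abs_sum_le_sum_abs (fun α => ha.height (g α)) (R.positiveRoots a)
  rw [← ha.two_mul_height_apply_rho, ha.sum_abs_height_apply hg, abs_mul, abs_two] at htriangle
  linarith

theorem eq_one_of_height_apply_rho_eq (ha : R.IsSimpleSystem a) {g : V ≃ₗᵢ[ℝ] V}
    (hg : g ∈ R.weylGroup) (h : ha.height (g (R.rho a)) = ha.height (R.rho a)) : g = 1 := by
  have hsum : ∑ α ∈ R.positiveRoots a, ha.height (g α) =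
      ∑ α ∈ R.positiveRoots a, |ha.height (g α)| := by
    rw [← ha.two_mul_height_apply_rho, ha.sum_abs_height_apply hg, h]
  rw [Finset.sum_eq_sum_iff_of_le fun α _ => le_abs_self _] at hsum
  refine ha.eq_one_of_forall_mem_positiveRoots hg fun i => ?_
  refine ha.mem_positiveRoots_of_height_nonneg (R.apply_mem_roots hg (ha.mem_roots i)) ?_
  rw [hsum _ (ha.simple_mem_positiveRoots i)]
  exact abs_nonneg _

end IsSimpleSystem

end IntegralRootSystem

/-! ### The Weyl denominator formula -/

namespace IntegralRootSystem

open AddMonoidAlgebra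

variable {V : Type*} [NormedAddCommGroup V] [InnerProductSpace ℝ V] (R : IntegralRootSystem V)

/-- The sign character of the Weyl group: the determinant, with values in `ℂ`. -/
def weylSign : R.weylGroup →* ℂ where
  toFun s := ((LinearMap.det (s.1.toLinearEquiv : V →ₗ[ℝ] V) : ℝ) : ℂ)
  map_one' := by
    have hone : ((1 : R.weylGroup).1.toLinearEquiv : V →ₗ[ℝ] V) = LinearMap.id := rfl
    rw [hone, LinearMap.det_id, Complex.ofReal_one]
  map_mul' s t := by
    have hmul : ((s * t).1.toLinearEquiv : V →ₗ[ℝ] V) =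
      (s.1.toLinearEquiv : V →ₗ[ℝ] V) * (t.1.toLinearEquiv : V →ₗ[ℝ] V) := rfl
    rw [hmul, map_mul, Complex.ofReal_mul]

theorem weylSign_apply (s : R.weylGroup) :
    R.weylSign s = ((LinearMap.det (s.1.toLinearEquiv : V →ₗ[ℝ] V) : ℝ) : ℂ) := rfl

theorem weylSign_rootReflection [FiniteDimensional ℝ V] {α : V} (hα : α ∈ R.roots) :
    R.weylSign ⟨rootReflection α, R.rootReflection_mem_weylGroup hα⟩ = -1 := by
  rw [weylSign_apply, det_rootReflection (R.ne_zero_of_mem hα), Complex.ofReal_neg,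
    Complex.ofReal_one]

theorem norm_weylSign (s : R.weylGroup) : ‖R.weylSign s‖ = 1 :=
  Complex.norm_eq_one_of_pow_eq_one
    (by rw [← map_pow, pow_card_eq_one, map_one]) (Fintype.card_ne_zero (α := R.weylGroup))

/-- The alternating sum `∑ det(s) e^{sν}` in the group algebra of `V`. -/
def formalAlternatingSum (ν : V) : AddMonoidAlgebra ℂ V :=
  ∑ s : R.weylGroup, single (s.1 ν) (R.weylSign s)

open Classical in
theorem coeff_formalAlternatingSum (ν y : V) :
    (R.formalAlternatingSum ν).coeff y =
      ∑ s : R.weylGroup, if s.1 ν = y then R.weylSign s else 0 := by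
  simp [formalAlternatingSum, Finsupp.single_apply]

theorem exists_apply_eq_of_coeff_formalAlternatingSum_ne_zero {ν y : V}
    (h : (R.formalAlternatingSum ν).coeff y ≠ 0) : ∃ s : R.weylGroup, s.1 ν = y := by
  classical
  by_contra! hcon
  exact h (by rw [coeff_formalAlternatingSum, Finset.sum_eq_zero fun s _ => if_neg (hcon s)])

theorem expEval_formalAlternatingSum (φ : V →+ ℂ) (ν : V) :
    expEval φ (R.formalAlternatingSum ν) =
      ∑ s : R.weylGroup, R.weylSign s * Complex.exp (φ (s.1 ν)) := by
  simp [formalAlternatingSum, expEval_single]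

namespace IsSimpleSystem

variable {R} {r : ℕ} {a : Fin r → V}

theorem mk_rootReflection_of_mem_integralWeights (ha : R.IsSimpleSystem a) {ν : V}
    (hν : ν ∈ integralWeights a) {α : V} (hα : α ∈ R.roots) :
    (rootReflection α ν : V ⧸ AddSubgroup.zmultiples α) = ν := by
  obtain ⟨m, hm⟩ := ha.exists_int_of_mem_integralWeights hν hα
  rw [rootReflection_apply, hm, Int.cast_smul_eq_zsmul, QuotientAddGroup.eq]
  exact AddSubgroup.mem_zmultiples_iff.2 ⟨m, by abel⟩

theorem reduceModZMultiples_formalAlternatingSum [FiniteDimensional ℝ V]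
    (ha : R.IsSimpleSystem a) {ν : V} (hν : ν ∈ integralWeights a) {α : V} (hα : α ∈ R.roots) :
    reduceModZMultiples ℂ α (R.formalAlternatingSum ν) = 0 := by
  let σ : R.weylGroup := ⟨rootReflection α, R.rootReflection_mem_weylGroup hα⟩
  have hσσ : σ * σ = 1 := Subtype.ext (rootReflection_mul_self α)
  have hsign : R.weylSign σ = -1 := R.weylSign_rootReflection hα
  have hreduce (s : R.weylGroup) :
      (((σ * s).1 ν : V) : V ⧸ AddSubgroup.zmultiples α) = (s.1 ν : V) :=
    ha.mk_rootReflection_of_mem_integralWeights (ha.apply_mem_integralWeights s.2 hν) hα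
  simp only [formalAlternatingSum, map_sum, reduceModZMultiples_single]
  refine Finset.sum_involution (fun s _ => σ * s) (fun s _ => ?_) (fun s _ _ hfix => ?_)
    (fun _ _ => Finset.mem_univ _) (fun s _ => by rw [← mul_assoc, hσσ, one_mul])
  · rw [hreduce, map_mul, hsign, neg_one_mul, single_neg, add_neg_cancel]
  · rw [mul_eq_right.1 hfix, map_one] at hsign
    norm_num at hsign

theorem prod_single_sub_one_dvd_formalAlternatingSum [FiniteDimensional ℝ V]
    (ha : R.IsSimpleSystem a) {ν : V} (hν : ν ∈ integralWeights a) :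
    (∏ α ∈ R.positiveRoots a, (single α 1 - 1)) ∣ R.formalAlternatingSum ν :=
  prod_single_sub_one_dvd _
    (fun _ hα _ hβ hne => ha.eq_zero_of_zsmul_eq_zsmul hα hβ hne)
    fun _ hα => ha.reduceModZMultiples_formalAlternatingSum hν
      (R.mem_roots_of_mem_positiveRoots hα)

theorem height_mem_Icc_of_coeff_formalAlternatingSum_rho_ne_zero (ha : R.IsSimpleSystem a) {y : V}
    (hy : (R.formalAlternatingSum (R.rho a)).coeff y ≠ 0) :
    ha.height y ∈ Set.Icc (-ha.height (R.rho a)) (ha.height (R.rho a)) := by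
  obtain ⟨s, rfl⟩ := R.exists_apply_eq_of_coeff_formalAlternatingSum_ne_zero hy
  exact abs_le.1 (ha.abs_height_apply_rho_le s.2)

open Classical in
theorem coeff_formalAlternatingSum_rho_of_height_eq (ha : R.IsSimpleSystem a) {y : V}
    (hy : ha.height y = ha.height (R.rho a)) :
    (R.formalAlternatingSum (R.rho a)).coeff y = if y = R.rho a then 1 else 0 := by
  rw [coeff_formalAlternatingSum, Finset.sum_eq_single (1 : R.weylGroup) _ (by simp)]
  · simp [eq_comm]
  · refine fun s _ hs => if_neg fun hsy => hs (Subtype.ext ?_)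
    exact ha.eq_one_of_height_apply_rho_eq s.2 (by rw [hsy, hy])

theorem formalAlternatingSum_rho [FiniteDimensional ℝ V] (ha : R.IsSimpleSystem a) :
    R.formalAlternatingSum (R.rho a) =
      (∏ α ∈ R.positiveRoots a, (single α 1 - 1)) * single (-R.rho a) 1 := by
  classical
  obtain ⟨Q, hQ⟩ := ha.prod_single_sub_one_dvd_formalAlternatingSum ha.rho_mem_integralWeights
  have hpos : ∀ α ∈ R.positiveRoots a, 0 < ha.height.toAddMonoidHom α := fun α hα =>
    zero_lt_one.trans_le (ha.one_le_height hα)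
  have hJ : ∀ y, ((∏ α ∈ R.positiveRoots a, (single α 1 - 1)) * Q).coeff y ≠ 0 →
      ha.height.toAddMonoidHom y ∈ Set.Icc (-ha.height (R.rho a)) (ha.height (R.rho a)) :=
    fun y hy => ha.height_mem_Icc_of_coeff_formalAlternatingSum_rho_ne_zero (hQ ▸ hy)
  have hbot : ha.height (R.rho a) - ∑ α ∈ R.positiveRoots a, ha.height.toAddMonoidHom α =
      -ha.height (R.rho a) := by
    rw [← map_sum, ← R.rho_add_rho, LinearMap.toAddMonoidHom_coe, map_add]
    ring
  rw [hQ]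
  congr 1
  ext y
  rw [coeff_single, Finsupp.single_apply]
  by_cases hy : ha.height y = -ha.height (R.rho a)
  · have hshift := coeff_prod_single_sub_one_mul_add_sum_of_height_eq _ _ hpos hJ
      (y := y) (hy.trans hbot.symm)
    rw [← hQ, ← R.rho_add_rho, ha.coeff_formalAlternatingSum_rho_of_height_eq
      (by rw [map_add, map_add, hy]; ring)] at hshift
    rw [← hshift]
    congr 1
    rw [← add_assoc, add_eq_right, add_eq_zero_iff_eq_neg]
    exact propext eq_comm
  · rw [if_neg fun h => hy (by rw [← h, map_neg])]
    by_contra hc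
    have hrange := height_mem_Icc_of_prod_single_sub_one_mul _ _ hpos hJ y hc
    rw [hbot, Set.Icc_self] at hrange
    exact hy hrange

end IsSimpleSystem

end IntegralRootSystem

/-! ### Values of exponential sums -/

section ExpEval

open AddMonoidAlgebra

variable {V : Type*} [NormedAddCommGroup V] [InnerProductSpace ℝ V]

theorem differentiable_expEval_add_smul {A : Type*} [AddCommGroup A] (φ ψ : A →+ ℂ)
    (G : AddMonoidAlgebra ℂ A) : Differentiable ℂ fun z : ℂ => expEval (φ + z • ψ) G := by
  induction G using AddMonoidAlgebra.induction_linear with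
  | zero => simp
  | add f g hf hg =>
    simp only [map_add]
    exact hf.add hg
  | single y c =>
    simp only [expEval_single, AddMonoidHom.add_apply, AddMonoidHom.smul_apply]
    fun_prop

/-- The phase `ν ↦ i⟨ν, H⟩`, so that `expEval (innerPhase H)` evaluates an exponential sum at the
point `H`. -/
def innerPhase (H : V) : V →+ ℂ where
  toFun ν := Complex.I * (⟪ν, H⟫_ℝ : ℝ)
  map_zero' := by simp
  map_add' x y := by rw [inner_add_left, Complex.ofReal_add, mul_add]

theorem innerPhase_apply (H ν : V) : innerPhase H ν = Complex.I * (⟪ν, H⟫_ℝ : ℝ) := rfl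

theorem continuous_expEval_innerPhase (G : AddMonoidAlgebra ℂ V) :
    Continuous fun H => expEval (innerPhase H) G := by
  induction G using AddMonoidAlgebra.induction_linear with
  | zero => simpa using continuous_const
  | add f g hf hg =>
    simp only [map_add]
    exact hf.add hg
  | single y c =>
    simp only [expEval_single, innerPhase_apply]
    fun_prop

theorem exists_norm_expEval_innerPhase_le (G : AddMonoidAlgebra ℂ V) :
    ∃ M, ∀ H, ‖expEval (innerPhase H) G‖ ≤ M := by
  induction G using AddMonoidAlgebra.induction_linear with
  | zero => exact ⟨0, by simp⟩
  | add f g hf hg =>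
    obtain ⟨M₁, h₁⟩ := hf
    obtain ⟨M₂, h₂⟩ := hg
    refine ⟨M₁ + M₂, fun H => ?_⟩
    rw [map_add]
    exact (norm_add_le _ _).trans (add_le_add (h₁ H) (h₂ H))
  | single y c =>
    refine ⟨‖c‖, fun H => ?_⟩
    rw [expEval_single, innerPhase_apply, norm_mul, Complex.norm_exp_I_mul_ofReal, mul_one]

end ExpEval

/-! ### The Weyl character as an exponential sum -/

namespace IntegralRootSystem

open AddMonoidAlgebra

variable {V : Type*} [NormedAddCommGroup V] [InnerProductSpace ℝ V] (R : IntegralRootSystem V)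

theorem alternatingSum_eq_expEval (ν H : V) :
    R.alternatingSum ν H = expEval (innerPhase H) (R.formalAlternatingSum ν) := by
  simp only [alternatingSum, expEval_formalAlternatingSum, weylSign_apply, innerPhase_apply]

namespace IsSimpleSystem

variable {R} {r : ℕ} {a : Fin r → V}

theorem exists_inner_eq_height [FiniteDimensional ℝ V] (ha : R.IsSimpleSystem a) :
    ∃ δ : V, ∀ ν, ⟪ν, δ⟫_ℝ = ha.height ν := by
  refine ⟨(InnerProductSpace.toDual ℝ V).symm (LinearMap.toContinuousLinearMap ha.height),
    fun ν => ?_⟩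
  rw [real_inner_comm, InnerProductSpace.toDual_symm_apply, LinearMap.coe_toContinuousLinearMap']

variable [FiniteDimensional ℝ V]

theorem expEval_formalAlternatingSum_rho (ha : R.IsSimpleSystem a) (φ : V →+ ℂ) :
    expEval φ (R.formalAlternatingSum (R.rho a)) =
      (∏ α ∈ R.positiveRoots a, (Complex.exp (φ α) - 1)) * Complex.exp (-φ (R.rho a)) := by
  rw [ha.formalAlternatingSum_rho, map_mul, map_prod]
  simp [expEval_single]

theorem alternatingSum_rho (ha : R.IsSimpleSystem a) (H : V) :
    R.alternatingSum (R.rho a) H = R.denominatorProduct a H := by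
  rw [alternatingSum_eq_expEval, ha.expEval_formalAlternatingSum_rho, denominatorProduct, mul_comm]
  simp only [innerPhase_apply]

theorem alternatingSum_rho_ne_zero (ha : R.IsSimpleSystem a) {H : V}
    (hH : ∀ α ∈ R.positiveRoots a, ∀ m : ℤ, ⟪α, H⟫_ℝ ≠ 2 * Real.pi * m) :
    R.alternatingSum (R.rho a) H ≠ 0 := by
  rw [ha.alternatingSum_rho, denominatorProduct]
  refine mul_ne_zero (Complex.exp_ne_zero _)
    (Finset.prod_ne_zero_iff.2 fun α hα hzero => ?_)
  obtain ⟨m, hm⟩ := Complex.exp_eq_one_iff.1 (sub_eq_zero.1 hzero)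
  refine hH α hα m (Complex.ofReal_injective (mul_left_cancel₀ Complex.I_ne_zero (hm.trans ?_)))
  push_cast
  ring

theorem dense_alternatingSum_rho_ne_zero (ha : R.IsSimpleSystem a) :
    Dense {H | R.alternatingSum (R.rho a) H ≠ 0} := by
  intro H
  obtain ⟨δ, hδ⟩ := ha.exists_inner_eq_height
  let walls : Set ℝ := ⋃ α ∈ R.positiveRoots a,
    Set.range fun m : ℤ => (2 * Real.pi * m - ⟪α, H⟫_ℝ) / ha.height α
  have hwalls : walls.Countable :=
    (R.positiveRoots a).countable_toSet.biUnion fun _ _ => Set.countable_range _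
  have hmaps : Set.MapsTo (fun t : ℝ => H + t • δ) wallsᶜ
      {H | R.alternatingSum (R.rho a) H ≠ 0} := by
    intro t ht
    refine ha.alternatingSum_rho_ne_zero fun α hα m hm => ht (Set.mem_biUnion hα ⟨m, ?_⟩)
    have hheight : ha.height α ≠ 0 := (zero_lt_one.trans_le (ha.one_le_height hα)).ne'
    rw [inner_add_right, real_inner_smul_right, hδ] at hm
    exact (div_eq_iff hheight).2 (by linarith)
  have hcont : Continuous fun t : ℝ => H + t • δ := by fun_prop
  simpa using hmaps.closure hcont ((hwalls.dense_compl ℝ) 0)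

theorem formalAlternatingSum_rho_dvd (ha : R.IsSimpleSystem a) {ν : V}
    (hν : ν ∈ integralWeights a) :
    R.formalAlternatingSum (R.rho a) ∣ R.formalAlternatingSum ν := by
  have hunit : IsUnit (single (-R.rho a) 1 : AddMonoidAlgebra ℂ V) :=
    .of_mul_eq_one (single (R.rho a) 1) (by
      rw [single_mul_single, neg_add_cancel, mul_one, one_def])
  rw [ha.formalAlternatingSum_rho, hunit.mul_right_dvd]
  exact ha.prod_single_sub_one_dvd_formalAlternatingSum hν

/-- The Weyl character of an integral weight as an element of the group algebra: the quotient of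
the formal alternating sums of `ν` and `ρ`. -/
def formalCharacter (ha : R.IsSimpleSystem a) {ν : V} (hν : ν ∈ integralWeights a) :
    AddMonoidAlgebra ℂ V :=
  (ha.formalAlternatingSum_rho_dvd hν).choose

theorem formalAlternatingSum_rho_mul_formalCharacter (ha : R.IsSimpleSystem a) {ν : V}
    (hν : ν ∈ integralWeights a) :
    R.formalAlternatingSum (R.rho a) * ha.formalCharacter hν = R.formalAlternatingSum ν :=
  (ha.formalAlternatingSum_rho_dvd hν).choose_spec.symm

theorem expEval_innerPhase_formalCharacter (ha : R.IsSimpleSystem a) {ν : V}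
    (hν : ν ∈ integralWeights a) {H : V} (hH : R.alternatingSum (R.rho a) H ≠ 0) :
    expEval (innerPhase H) (ha.formalCharacter hν) =
      R.alternatingSum ν H / R.alternatingSum (R.rho a) H := by
  rw [eq_div_iff hH, alternatingSum_eq_expEval, alternatingSum_eq_expEval,
    ← ha.formalAlternatingSum_rho_mul_formalCharacter hν, map_mul, mul_comm]

theorem weylCharacter_eq_expEval (ha : R.IsSimpleSystem a) {ν : V} (hν : ν ∈ integralWeights a)
    (H : V) : R.weylCharacter a ν H = expEval (innerPhase H) (ha.formalCharacter hν) := by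
  refine extendFrom_eq (ha.dense_alternatingSum_rho_ne_zero H) ?_
  refine ((continuous_expEval_innerPhase (ha.formalCharacter hν)).tendsto H).mono_left
    nhdsWithin_le_nhds |>.congr' ?_
  filter_upwards [self_mem_nhdsWithin] with H' hH'
  exact ha.expEval_innerPhase_formalCharacter hν hH'

theorem continuous_weylCharacter (ha : R.IsSimpleSystem a) {ν : V}
    (hν : ν ∈ integralWeights a) : Continuous (R.weylCharacter a ν) :=
  (continuous_expEval_innerPhase (ha.formalCharacter hν)).congr fun H =>
    (ha.weylCharacter_eq_expEval hν H).symm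

theorem weylCharacter_eq_div (ha : R.IsSimpleSystem a) {ν : V} (hν : ν ∈ integralWeights a)
    {H : V} (hH : R.alternatingSum (R.rho a) H ≠ 0) :
    R.weylCharacter a ν H = R.alternatingSum ν H / R.alternatingSum (R.rho a) H := by
  rw [ha.weylCharacter_eq_expEval hν, ha.expEval_innerPhase_formalCharacter hν hH]

end IsSimpleSystem

end IntegralRootSystem

/-! ### Iterated differences -/

section IteratedDifference

variable {r : ℕ}

theorem iteratedDifference_const_mul (l : List (Fin r)) (c : ℂ) (f : (Fin r → ℤ) → ℂ)
    (n : Fin r → ℤ) :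
    iteratedDifference l (fun m => c * f m) n = c * iteratedDifference l f n := by
  induction l generalizing n with
  | nil => rfl
  | cons i l ih => simp only [iteratedDifference, fwdDiff, ih, mul_sub]

theorem iteratedDifference_sum_of_add_single_eq_mul {ι : Type*} (t : Finset ι)
    (E : ι → (Fin r → ℤ) → ℂ) (w : ι → Fin r → ℂ)
    (hE : ∀ s n i, E s (n + Pi.single i 1) = E s n * w s i) (l : List (Fin r)) (n : Fin r → ℤ) :
    iteratedDifference l (fun m => ∑ s ∈ t, E s m) n =
      ∑ s ∈ t, E s n * (l.map fun i => w s i - 1).prod := by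
  induction l generalizing n with
  | nil => simp [iteratedDifference]
  | cons i l ih =>
    simp only [iteratedDifference, fwdDiff, ih, hE, List.map_cons, List.prod_cons]
    rw [← Finset.sum_sub_distrib]
    exact Finset.sum_congr rfl fun s _ => by ring

theorem differentiable_iteratedDifference (l : List (Fin r)) {f : ℂ → (Fin r → ℤ) → ℂ}
    (hf : ∀ n, Differentiable ℂ fun z => f z n) (n : Fin r → ℤ) :
    Differentiable ℂ fun z => iteratedDifference l (f z) n := by
  induction l generalizing n with
  | nil => exact hf n
  | cons i l ih => exact (ih _).sub (ih _)

theorem exists_norm_iteratedDifference_le {X : Type*} (l : List (Fin r))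
    {f : X → (Fin r → ℤ) → ℂ} (hf : ∀ n, ∃ M, ∀ x, ‖f x n‖ ≤ M) (n : Fin r → ℤ) :
    ∃ M, ∀ x, ‖iteratedDifference l (f x) n‖ ≤ M := by
  induction l generalizing n with
  | nil => exact hf n
  | cons i l ih =>
    obtain ⟨M₁, h₁⟩ := ih (n + Pi.single i 1)
    obtain ⟨M₂, h₂⟩ := ih n
    exact ⟨M₁ + M₂, fun x => (norm_sub_le _ _).trans (add_le_add (h₁ x) (h₂ x))⟩

theorem finite_setOf_forall_abs_le {ι : Type*} [Finite ι] (L : ℝ) :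
    {n : ι → ℤ | ∀ i, |(n i : ℝ)| ≤ L}.Finite := by
  refine Set.Finite.pi' (t := fun _ => {m : ℤ | |(m : ℝ)| ≤ L}) fun _ => ?_
  have hIcc : {m : ℤ | |(m : ℝ)| ≤ L} = Set.Icc ⌈-L⌉ ⌊L⌋ := by
    ext m
    simp only [Set.mem_ofPred_eq, abs_le, Set.mem_Icc, Int.ceil_le, Int.le_floor]
  exact hIcc ▸ Set.finite_Icc _ _

end IteratedDifference

/-! ### Estimates on complex lines -/

section ComplexEstimates

theorem half_norm_le_norm_exp_sub_one {u : ℂ} (hu : ‖u‖ ≤ 1 / 2) :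
    ‖u‖ / 2 ≤ ‖Complex.exp u - 1‖ := by
  have hremainder := Complex.norm_exp_sub_one_sub_id_le (x := u) (by linarith)
  have htriangle := norm_sub_le (Complex.exp u - 1) (Complex.exp u - 1 - u)
  rw [sub_sub_cancel] at htriangle
  nlinarith [norm_nonneg u]

theorem exp_I_mul_add_sub_two_pi_mul (x : ℝ) (w : ℂ) (m : ℤ) :
    Complex.exp (Complex.I * ((x - 2 * Real.pi * m : ℝ) + w)) =
      Complex.exp (Complex.I * (x + w)) := by
  rw [Complex.exp_eq_exp_iff_exists_int]
  refine ⟨-m, ?_⟩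
  push_cast
  ring

variable {x b : ℝ} {m : ℤ} {w : ℂ}

theorem norm_exp_I_mul_add_sub_one_le (hx : |x - 2 * Real.pi * m| ≤ b) (hw : b + ‖w‖ ≤ 1) :
    ‖Complex.exp (Complex.I * (x + w)) - 1‖ ≤ 2 * (b + ‖w‖) := by
  have hnorm : ‖Complex.I * ((x - 2 * Real.pi * m : ℝ) + w)‖ ≤ b + ‖w‖ := by
    rw [norm_mul, Complex.norm_I, one_mul]
    refine (norm_add_le _ _).trans (add_le_add_left ?_ _)
    rwa [Complex.norm_real, Real.norm_eq_abs]
  rw [← exp_I_mul_add_sub_two_pi_mul x w m]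
  refine (Complex.norm_exp_sub_one_le (hnorm.trans hw)).trans ?_
  linarith

theorem half_le_norm_exp_I_mul_add_sub_one (hx : |x - 2 * Real.pi * m| ≤ b)
    (hw : b + ‖w‖ ≤ 1 / 2) :
    (‖w‖ - b) / 2 ≤ ‖Complex.exp (Complex.I * (x + w)) - 1‖ := by
  have hreal : ‖((x - 2 * Real.pi * m : ℝ) : ℂ)‖ ≤ b := by
    rwa [Complex.norm_real, Real.norm_eq_abs]
  have hnorm : ‖Complex.I * ((x - 2 * Real.pi * m : ℝ) + w)‖ =
      ‖((x - 2 * Real.pi * m : ℝ) : ℂ) + w‖ := by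
    rw [norm_mul, Complex.norm_I, one_mul]
  have hupper := norm_add_le ((x - 2 * Real.pi * m : ℝ) : ℂ) w
  have hlower := norm_sub_le (((x - 2 * Real.pi * m : ℝ) : ℂ) + w) (x - 2 * Real.pi * m : ℝ)
  rw [add_sub_cancel_left] at hlower
  rw [← exp_I_mul_add_sub_two_pi_mul x w m]
  refine le_trans ?_ (half_norm_le_norm_exp_sub_one (by linarith))
  linarith

theorem norm_apply_zero_le_div_of_forall_sphere {g d : ℂ → ℂ} (hg : Differentiable ℂ g)
    {ρ δ M : ℝ} (hρ : 0 < ρ) (hδ : 0 < δ) (hd : ∀ z, ‖z‖ = ρ → δ ≤ ‖d z‖)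
    (hdg : ∀ z, ‖z‖ = ρ → ‖d z * g z‖ ≤ M) : ‖g 0‖ ≤ M / δ := by
  refine Complex.norm_le_of_forall_mem_frontier_norm_le (U := Metric.ball (0 : ℂ) ρ)
    Metric.isBounded_ball hg.diffContOnCl (fun z hz => ?_)
    (subset_closure (Metric.mem_ball_self hρ))
  rw [frontier_ball _ hρ.ne', mem_sphere_zero_iff_norm] at hz
  rw [le_div_iff₀' hδ]
  calc δ * ‖g z‖ ≤ ‖d z‖ * ‖g z‖ := mul_le_mul_of_nonneg_right (hd z hz) (norm_nonneg _)
    _ = ‖d z * g z‖ := (norm_mul _ _).symm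
    _ ≤ M := hdg z hz

theorem exists_abs_sub_two_pi_mul_le {x b : ℝ}
    (hx : ‖((1 / (2 * Real.pi) * x : ℝ) : UnitAddCircle)‖ ≤ b) :
    ∃ m : ℤ, |x - 2 * Real.pi * m| ≤ 2 * Real.pi * b := by
  rw [UnitAddCircle.norm_eq] at hx
  refine ⟨round (1 / (2 * Real.pi) * x), ?_⟩
  have hrescale : x - 2 * Real.pi * round (1 / (2 * Real.pi) * x) =
      2 * Real.pi * (1 / (2 * Real.pi) * x - round (1 / (2 * Real.pi) * x)) := by
    field_simp
  rw [hrescale, abs_mul, abs_of_pos Real.two_pi_pos]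
  exact mul_le_mul_of_nonneg_left hx Real.two_pi_pos.le

end ComplexEstimates

/-! ### Difference estimates for Weyl characters -/

namespace IntegralRootSystem

namespace IsSimpleSystem

variable {V : Type*} [NormedAddCommGroup V] [InnerProductSpace ℝ V] {R : IntegralRootSystem V}
  {r : ℕ} {a : Fin r → V}

theorem sum_smul_add_mem_integralWeights (ha : R.IsSimpleSystem a) {μ : V}
    (hμ : μ ∈ integralWeights a) (n : Fin r → ℤ) :
    ∑ i, (n i : ℝ) • a i + μ ∈ integralWeights a := by
  refine add_mem (sum_mem fun i _ => ?_) hμ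
  rw [Int.cast_smul_eq_zsmul]
  exact zsmul_mem (ha.simple_mem_integralWeights i) _

/-- The phase `ν ↦ i ht(ν)`, the direction in which the phase `innerPhase H` is moved into the
complex domain: every root has nonzero height, so `innerPhase H + z • heightPhase` moves away from
the walls. -/
def heightPhase (ha : R.IsSimpleSystem a) : V →+ ℂ where
  toFun ν := Complex.I * (ha.height ν : ℝ)
  map_zero' := by simp
  map_add' x y := by rw [map_add, Complex.ofReal_add, mul_add]

theorem innerPhase_add_smul_heightPhase_apply (ha : R.IsSimpleSystem a) (H : V) (z : ℂ) (ν : V) :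
    (innerPhase H + z • ha.heightPhase) ν =
      Complex.I * ((⟪ν, H⟫_ℝ : ℝ) + z * (ha.height ν : ℝ)) := by
  rw [mul_add, mul_left_comm]
  rfl

theorem abs_re_innerPhase_add_smul_heightPhase_le (ha : R.IsSimpleSystem a) (H : V) (z : ℂ)
    (ν : V) : |((innerPhase H + z • ha.heightPhase) ν).re| ≤ ‖z‖ * |ha.height ν| := by
  have hre : ((innerPhase H + z • ha.heightPhase) ν).re = -(z.im * ha.height ν) := by
    rw [innerPhase_add_smul_heightPhase_apply]
    simp
  rw [hre, abs_neg, abs_mul]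
  exact mul_le_mul_of_nonneg_right (Complex.abs_im_le_norm z) (abs_nonneg _)

theorem exists_forall_roots_abs_sub_two_pi_mul_le (ha : R.IsSimpleSystem a) {H : V} {b : ℝ}
    (hH : ∀ α ∈ R.positiveRoots a, ∃ m : ℤ, |⟪α, H⟫_ℝ - 2 * Real.pi * m| ≤ b) {β : V}
    (hβ : β ∈ R.roots) : ∃ m : ℤ, |⟪β, H⟫_ℝ - 2 * Real.pi * m| ≤ b := by
  rcases ha.mem_or_neg_mem hβ with hpos | hneg
  · exact hH β hpos
  · obtain ⟨m, hm⟩ := hH _ hneg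
    refine ⟨-m, ?_⟩
    rw [inner_neg_left, ← abs_neg] at hm
    convert hm using 2
    push_cast
    ring

theorem exists_forall_abs_height_le (ha : R.IsSimpleSystem a) :
    ∃ h, 1 ≤ h ∧ ∀ β ∈ R.roots, |ha.height β| ≤ h := by
  obtain ⟨h, hh⟩ := (R.roots.image fun β => |ha.height β|).exists_le
  exact ⟨max 1 h, le_max_left _ _, fun β hβ =>
    (hh _ (Finset.mem_image_of_mem _ hβ)).trans (le_max_right _ _)⟩

theorem exists_abs_height_apply_sum_smul_add_le (ha : R.IsSimpleSystem a) (μ : V) (A : ℝ) :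
    ∃ K, ∀ N : ℝ, 1 ≤ N → ∀ n : Fin r → ℤ, (∀ i, |(n i : ℝ)| ≤ A * N) → ∀ s : R.weylGroup,
      |ha.height (s.1 (∑ i, (n i : ℝ) • a i + μ))| ≤ K * N := by
  obtain ⟨K, hK⟩ := Finite.exists_le fun s : R.weylGroup =>
    ∑ i, A * |ha.height (s.1 (a i))| + |ha.height (s.1 μ)|
  refine ⟨K, fun N hN n hn s => ?_⟩
  calc |ha.height (s.1 (∑ i, (n i : ℝ) • a i + μ))|
      = |∑ i, n i * ha.height (s.1 (a i)) + ha.height (s.1 μ)| := by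
        simp only [map_add, map_sum, map_smul, smul_eq_mul]
    _ ≤ ∑ i, |n i * ha.height (s.1 (a i))| + |ha.height (s.1 μ)| :=
        (abs_add_le _ _).trans (add_le_add_left (Finset.abs_sum_le_sum_abs _ _) _)
    _ ≤ ∑ i, A * N * |ha.height (s.1 (a i))| + |ha.height (s.1 μ)| * N := by
        refine add_le_add (Finset.sum_le_sum fun i _ => ?_)
          (le_mul_of_one_le_right (abs_nonneg _) hN)
        rw [abs_mul]
        exact mul_le_mul_of_nonneg_right (hn i) (abs_nonneg _)
    _ = (∑ i, A * |ha.height (s.1 (a i))| + |ha.height (s.1 μ)|) * N := by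
        simp only [add_mul, Finset.sum_mul, mul_right_comm]
    _ ≤ K * N := mul_le_mul_of_nonneg_right (hK s) (zero_le_one.trans hN)

theorem norm_sum_weylSign_mul_exp_mul_prod_le (ha : R.IsSimpleSystem a) {φ : V →+ ℂ} {ν : V}
    {T ε : ℝ} (hν : ∀ s : R.weylGroup, (φ (s.1 ν)).re ≤ T)
    (hroots : ∀ β ∈ R.roots, ‖Complex.exp (φ β) - 1‖ ≤ ε) (l : List (Fin r)) :
    ‖∑ s : R.weylGroup, R.weylSign s * Complex.exp (φ (s.1 ν)) *
        (l.map fun i => Complex.exp (φ (s.1 (a i))) - 1).prod‖ ≤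
      Fintype.card R.weylGroup * (Real.exp T * ε ^ l.length) := by
  have hprod (s : R.weylGroup) :
      ‖(l.map fun i => Complex.exp (φ (s.1 (a i))) - 1).prod‖ ≤ ε ^ l.length := by
    induction l with
    | nil => simp
    | cons i l ih =>
      rw [List.map_cons, List.prod_cons, norm_mul, List.length_cons, pow_succ']
      have hε := hroots _ (R.apply_mem_roots s.2 (ha.mem_roots i))
      exact mul_le_mul hε ih (norm_nonneg _) ((norm_nonneg _).trans hε)
  refine (norm_sum_le_of_le (n := fun _ => Real.exp T * ε ^ l.length) _ fun s _ => ?_).trans_eq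
    (by rw [Finset.sum_const, nsmul_eq_mul, Finset.card_univ])
  rw [norm_mul, norm_mul, R.norm_weylSign, one_mul, Complex.norm_exp]
  exact mul_le_mul (Real.exp_le_exp.2 (hν s)) (hprod s) (norm_nonneg _) (Real.exp_pos _).le

variable [FiniteDimensional ℝ V]

theorem pow_mul_exp_neg_le_norm_expEval_formalAlternatingSum_rho (ha : R.IsSimpleSystem a)
    {φ : V →+ ℂ} {T δ : ℝ} (hδ : 0 ≤ δ) (hρ : (φ (R.rho a)).re ≤ T)
    (hroots : ∀ α ∈ R.positiveRoots a, δ ≤ ‖Complex.exp (φ α) - 1‖) :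
    δ ^ (R.positiveRoots a).card * Real.exp (-T) ≤
      ‖expEval φ (R.formalAlternatingSum (R.rho a))‖ := by
  rw [ha.expEval_formalAlternatingSum_rho, norm_mul, norm_prod, Complex.norm_exp, Complex.neg_re,
    ← Finset.prod_const]
  refine mul_le_mul (Finset.prod_le_prod (fun _ _ => hδ) hroots)
    (Real.exp_le_exp.2 (neg_le_neg hρ)) (Real.exp_pos _).le
    (Finset.prod_nonneg fun _ _ => norm_nonneg _)

theorem expEval_formalAlternatingSum_rho_mul_iteratedDifference (ha : R.IsSimpleSystem a) {μ : V}
    (hμ : μ ∈ integralWeights a) (φ : V →+ ℂ) (l : List (Fin r)) (n : Fin r → ℤ) :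
    expEval φ (R.formalAlternatingSum (R.rho a)) * iteratedDifference l (fun m =>
        expEval φ (ha.formalCharacter (ha.sum_smul_add_mem_integralWeights hμ m))) n =
      ∑ s : R.weylGroup, R.weylSign s * Complex.exp (φ (s.1 (∑ i, (n i : ℝ) • a i + μ))) *
        (l.map fun i => Complex.exp (φ (s.1 (a i))) - 1).prod := by
  rw [← iteratedDifference_const_mul]
  simp only [← map_mul, ha.formalAlternatingSum_rho_mul_formalCharacter]
  simp only [expEval_formalAlternatingSum]
  refine iteratedDifference_sum_of_add_single_eq_mul _
    (fun s m => R.weylSign s * Complex.exp (φ (s.1 (∑ i, (m i : ℝ) • a i + μ))))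
    (fun s i => Complex.exp (φ (s.1 (a i)))) (fun s m i => ?_) l n
  have hshift : ∑ j, ((m + Pi.single i 1 : Fin r → ℤ) j : ℝ) • a j + μ =
      ∑ j, (m j : ℝ) • a j + μ + a i := by
    simp only [Pi.add_apply, Pi.single_apply, Int.cast_add, Int.cast_ite, Int.cast_one,
      Int.cast_zero, add_smul, ite_smul, one_smul, zero_smul, Finset.sum_add_distrib,
      Finset.sum_ite_eq', Finset.mem_univ, if_true]
    abel
  rw [hshift, map_add, map_add, Complex.exp_add, mul_assoc]

theorem norm_iteratedDifference_weylCharacter_le (ha : R.IsSimpleSystem a) {μ : V}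
    (hμ : μ ∈ integralWeights a) {b h T : ℝ} (hb : 0 < b) (hh : 1 ≤ h)
    (hroots : ∀ β ∈ R.roots, |ha.height β| ≤ h) (hbh : 6 * b * h ≤ 1) {H : V}
    (hH : ∀ α ∈ R.positiveRoots a, ∃ m : ℤ, |⟪α, H⟫_ℝ - 2 * Real.pi * m| ≤ b)
    (hρ : b * |ha.height (R.rho a)| ≤ T) {n : Fin r → ℤ}
    (hn : ∀ s : R.weylGroup, b * |ha.height (s.1 (∑ i, (n i : ℝ) • a i + μ))| ≤ T)
    (l : List (Fin r)) :
    ‖iteratedDifference l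
        (fun m => R.weylCharacter a (∑ i, (m i : ℝ) • a i + μ) H) n‖ ≤
      Fintype.card R.weylGroup * (Real.exp (2 * T) * (6 * b * h) ^ l.length) /
        ((b / 2) ^ (R.positiveRoots a).card * Real.exp (-(2 * T))) := by
  let φ (z : ℂ) : V →+ ℂ := innerPhase H + z • ha.heightPhase
  let g (z : ℂ) : ℂ := iteratedDifference l (fun m =>
    expEval (φ z) (ha.formalCharacter (ha.sum_smul_add_mem_integralWeights hμ m))) n
  have hg : Differentiable ℂ g :=
    differentiable_iteratedDifference l (fun _ => differentiable_expEval_add_smul _ _ _) n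
  have hg_zero : iteratedDifference l
      (fun m => R.weylCharacter a (∑ i, (m i : ℝ) • a i + μ) H) n = g 0 := by
    simp only [g, φ, zero_smul, add_zero, ← ha.weylCharacter_eq_expEval]
  have hre {z : ℂ} (hz : ‖z‖ = 2 * b) {ν : V} (hν : b * |ha.height ν| ≤ T) :
      (φ z ν).re ≤ 2 * T := by
    have := (le_abs_self _).trans (ha.abs_re_innerPhase_add_smul_heightPhase_le H z ν)
    rw [hz] at this
    linarith
  have hnorm {z : ℂ} (hz : ‖z‖ = 2 * b) (β : V) :
      ‖z * (ha.height β : ℝ)‖ = 2 * b * |ha.height β| := by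
    rw [norm_mul, hz, Complex.norm_real, Real.norm_eq_abs]
  rw [hg_zero]
  refine norm_apply_zero_le_div_of_forall_sphere
    (d := fun z => expEval (φ z) (R.formalAlternatingSum (R.rho a))) hg (ρ := 2 * b)
    (by positivity) (by positivity) (fun z hz => ?_) (fun z hz => ?_)
  · refine ha.pow_mul_exp_neg_le_norm_expEval_formalAlternatingSum_rho (by positivity)
      (hre hz hρ) fun α hα => ?_
    obtain ⟨m, hm⟩ := hH α hα
    have hle := hroots α (R.mem_roots_of_mem_positiveRoots hα)
    have hge := (ha.one_le_height hα).trans (le_abs_self _)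
    rw [ha.innerPhase_add_smul_heightPhase_apply]
    refine le_trans ?_ (half_le_norm_exp_I_mul_add_sub_one hm ?_) <;> rw [hnorm hz] <;> nlinarith
  · rw [ha.expEval_formalAlternatingSum_rho_mul_iteratedDifference hμ]
    refine ha.norm_sum_weylSign_mul_exp_mul_prod_le (fun s => hre hz (hn s)) (fun β hβ => ?_) l
    obtain ⟨m, hm⟩ := ha.exists_forall_roots_abs_sub_two_pi_mul_le hH hβ
    have hle := hroots β hβ
    rw [ha.innerPhase_add_smul_heightPhase_apply]
    refine (norm_exp_I_mul_add_sub_one_le hm ?_).trans ?_ <;> rw [hnorm hz] <;> nlinarith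

theorem exists_norm_iteratedDifference_weylCharacter_le_of_abs_le (ha : R.IsSimpleSystem a)
    {μ : V} (hμ : μ ∈ integralWeights a) (L : ℝ) (k : ℕ) :
    ∃ M : ℝ, ∀ n : Fin r → ℤ, (∀ i, |(n i : ℝ)| ≤ L) → ∀ l : List (Fin r), l.length = k →
      ∀ H, ‖iteratedDifference l
        (fun m => R.weylCharacter a (∑ i, (m i : ℝ) • a i + μ) H) n‖ ≤ M := by
  have hfinite := (finite_setOf_forall_abs_le (ι := Fin r) L).prod
    (List.finite_length_eq (Fin r) k)
  have hbounded (p : (Fin r → ℤ) × List (Fin r)) : ∃ M : ℝ, ∀ H, ‖iteratedDifference p.2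
      (fun m => R.weylCharacter a (∑ i, (m i : ℝ) • a i + μ) H) p.1‖ ≤ M := by
    refine exists_norm_iteratedDifference_le p.2 (fun m => ?_) p.1
    simp only [ha.weylCharacter_eq_expEval (ha.sum_smul_add_mem_integralWeights hμ m)]
    exact exists_norm_expEval_innerPhase_le _
  choose M hM using hbounded
  obtain ⟨M', hM'⟩ := (hfinite.image M).bddAbove
  exact ⟨M', fun n hn l hl H => (hM (n, l) H).trans (hM' ⟨(n, l), ⟨hn, hl⟩, rfl⟩)⟩

theorem exists_norm_iteratedDifference_weylCharacter_le_of_large (ha : R.IsSimpleSystem a)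
    {μ : V} (hμ : μ ∈ integralWeights a) (A : ℝ) {B : ℝ} (hB : 0 < B) (k : ℕ) :
    ∃ N₀ C : ℝ, ∀ N : ℝ, 1 ≤ N → N₀ ≤ N → ∀ H : V,
      (∀ α ∈ R.positiveRoots a,
        ‖((1 / (2 * Real.pi) * ⟪α, H⟫_ℝ : ℝ) : UnitAddCircle)‖ ≤ B * N⁻¹) →
      ∀ n : Fin r → ℤ, (∀ i, |(n i : ℝ)| ≤ A * N) → ∀ l : List (Fin r), l.length = k →
        ‖iteratedDifference l
            (fun m => R.weylCharacter a (∑ i, (m i : ℝ) • a i + μ) H) n‖ ≤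
          C * N ^ (((R.positiveRoots a).card : ℤ) - (k : ℤ)) := by
  obtain ⟨K, hK⟩ := ha.exists_abs_height_apply_sum_smul_add_le μ A
  obtain ⟨h, hh, hroots⟩ := ha.exists_forall_abs_height_le
  let c : ℝ := 2 * Real.pi * B
  let T : ℝ := c * max K |ha.height (R.rho a)|
  have hc : 0 < c := by positivity
  refine ⟨6 * c * h, Fintype.card R.weylGroup * (Real.exp (2 * T) * (6 * c * h) ^ k) /
    ((c / 2) ^ (R.positiveRoots a).card * Real.exp (-(2 * T))), ?_⟩
  intro N hN hlarge H hH n hn l hl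
  have hN_pos : 0 < N := zero_lt_one.trans_le hN
  have hscale : 6 * (c * N⁻¹) * h = 6 * c * h * N⁻¹ := by ring
  have hwalls (α) (hα : α ∈ R.positiveRoots a) :
      ∃ m : ℤ, |⟪α, H⟫_ℝ - 2 * Real.pi * m| ≤ c * N⁻¹ := by
    simpa only [c, mul_assoc] using exists_abs_sub_two_pi_mul_le (hH α hα)
  have hρ : c * N⁻¹ * |ha.height (R.rho a)| ≤ T :=
    mul_le_mul (mul_le_of_le_one_right hc.le (inv_le_one_of_one_le₀ hN)) (le_max_right _ _)
      (abs_nonneg _) hc.le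
  have hweights (s : R.weylGroup) :
      c * N⁻¹ * |ha.height (s.1 (∑ i, (n i : ℝ) • a i + μ))| ≤ T :=
    calc c * N⁻¹ * |ha.height (s.1 (∑ i, (n i : ℝ) • a i + μ))|
        ≤ c * N⁻¹ * (K * N) := by gcongr; exact hK N hN n hn s
      _ = c * K := by field_simp
      _ ≤ T := mul_le_mul_of_nonneg_left (le_max_left _ _) hc.le
  refine (ha.norm_iteratedDifference_weylCharacter_le hμ (b := c * N⁻¹) (by positivity) hh hroots
    (by rw [hscale]; exact mul_inv_le_one_of_le₀ hlarge hN_pos.le) hwalls hρ hweights l).trans_eq ?_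
  rw [hl, hscale, mul_div_right_comm c, mul_pow, mul_pow (c / 2), inv_pow, inv_pow,
    zpow_sub₀ hN_pos.ne', zpow_natCast, zpow_natCast]
  field_simp

theorem exists_norm_iteratedDifference_weylCharacter_le_mul_zpow (ha : R.IsSimpleSystem a)
    {μ : V} (hμ : μ ∈ integralWeights a) {A B : ℝ} (hA : 0 ≤ A) (hB : 0 < B) (k : ℕ) :
    ∃ C : ℝ, 0 < C ∧ ∀ N : ℝ, 1 ≤ N → ∀ H : V,
      (∀ α ∈ R.positiveRoots a,
        ‖((1 / (2 * Real.pi) * ⟪α, H⟫_ℝ : ℝ) : UnitAddCircle)‖ ≤ B * N⁻¹) →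
      ∀ n : Fin r → ℤ, (∀ i, |(n i : ℝ)| ≤ A * N) → ∀ l : List (Fin r), l.length = k →
        ‖iteratedDifference l
            (fun m => R.weylCharacter a (∑ i, (m i : ℝ) • a i + μ) H) n‖ ≤
          C * N ^ (((R.positiveRoots a).card : ℤ) - (k : ℤ)) := by
  obtain ⟨N₀, C₁, hlarge⟩ :=
    ha.exists_norm_iteratedDifference_weylCharacter_le_of_large hμ A hB k
  obtain ⟨M, hsmall⟩ :=
    ha.exists_norm_iteratedDifference_weylCharacter_le_of_abs_le hμ (A * N₀) k
  refine ⟨max 1 (max C₁ (|M| * |N₀| ^ k)), lt_max_of_lt_left one_pos, ?_⟩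
  intro N hN H hH n hn l hl
  have hN_pos : 0 < N := zero_lt_one.trans_le hN
  rcases le_total N₀ N with hNN | hNN
  · refine (hlarge N hN hNN H hH n hn l hl).trans ?_
    gcongr
    exact (le_max_left _ _).trans (le_max_right _ _)
  · have hpow : 1 ≤ |N₀| ^ k * N ^ (((R.positiveRoots a).card : ℤ) - (k : ℤ)) :=
      calc (1 : ℝ) ≤ N ^ (R.positiveRoots a).card := one_le_pow₀ hN
        _ = N ^ k * N ^ (((R.positiveRoots a).card : ℤ) - (k : ℤ)) := by
          rw [← zpow_natCast N k, ← zpow_add₀ hN_pos.ne', add_sub_cancel, zpow_natCast]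
        _ ≤ |N₀| ^ k * N ^ (((R.positiveRoots a).card : ℤ) - (k : ℤ)) := by
          gcongr
          exact hNN.trans (le_abs_self _)
    calc _ ≤ M := hsmall n (fun i => (hn i).trans (by gcongr)) l hl H
      _ ≤ |M| := le_abs_self M
      _ ≤ |M| * (|N₀| ^ k * N ^ (((R.positiveRoots a).card : ℤ) - (k : ℤ))) :=
        le_mul_of_one_le_right (abs_nonneg _) hpow
      _ = |M| * |N₀| ^ k * N ^ (((R.positiveRoots a).card : ℤ) - (k : ℤ)) := by ring
      _ ≤ _ := by
        gcongr
        exact (le_max_right _ _).trans (le_max_right _ _)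

end IsSimpleSystem

end IntegralRootSystem

end

theorem mainTheorem6_general {V : Type*} [NormedAddCommGroup V] [InnerProductSpace ℝ V]
    [FiniteDimensional ℝ V] (R : IntegralRootSystem V) {r : ℕ} (a : Fin r → V)
    (ha : R.IsSimpleSystem a) (μ : V) (hμ : μ ∈ integralWeights a) :
    (∀ H : V, R.alternatingSum (R.rho a) H = R.denominatorProduct a H) ∧
    (∀ n : Fin r → ℤ,
      Continuous (R.weylCharacter a (∑ i, (n i : ℝ) • a i + μ)) ∧
      ∀ H : V, R.alternatingSum (R.rho a) H ≠ 0 →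
        R.weylCharacter a (∑ i, (n i : ℝ) • a i + μ) H =
          R.alternatingSum (∑ i, (n i : ℝ) • a i + μ) H / R.alternatingSum (R.rho a) H) ∧
    (∀ A B : ℝ, 0 < A → 0 < B → ∀ k : ℕ, ∃ C : ℝ, 0 < C ∧
      ∀ N : ℝ, 1 ≤ N → ∀ H : V,
        (∀ α ∈ R.positiveRoots a,
          ‖((1 / (2 * Real.pi) * ⟪α, H⟫_ℝ : ℝ) : UnitAddCircle)‖ ≤ B * N⁻¹) →
        ∀ n : Fin r → ℤ, (∀ i, |(n i : ℝ)| ≤ A * N) →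
          ∀ l : List (Fin r), l.length = k →
            ‖iteratedDifference l
                (fun m => R.weylCharacter a (∑ i, (m i : ℝ) • a i + μ) H) n‖ ≤
              C * N ^ (((R.positiveRoots a).card : ℤ) - (k : ℤ))) := by
  have hweight := ha.sum_smul_add_mem_integralWeights hμ
  exact ⟨ha.alternatingSum_rho,
    fun n => ⟨ha.continuous_weylCharacter (hweight n),
      fun _ => ha.weylCharacter_eq_div (hweight n)⟩,
    fun _ _ hA hB k =>
      ha.exists_norm_iteratedDifference_weylCharacter_le_mul_zpow hμ hA.le hB k⟩

theorem mainTheorem6 {V : Type*} [NormedAddCommGroup V] [InnerProductSpace ℝ V]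
    [FiniteDimensional ℝ V] (R : IntegralRootSystem V) {r : ℕ} (a : Fin r → V)
    (ha : R.IsSimpleSystem a) (μ : V) (hμ : μ ∈ weightLattice a) :
    -- the two forms of the Weyl denominator agree
    (∀ H : V, R.alternatingSum (R.rho a) H = R.denominatorProduct a H) ∧
    -- the characters are well defined: continuous, and equal to the quotient off the walls
    (∀ n : Fin r → ℤ,
      Continuous (R.weylCharacter a (∑ i, (n i : ℝ) • a i + μ)) ∧
      ∀ H : V, R.alternatingSum (R.rho a) H ≠ 0 →
        R.weylCharacter a (∑ i, (n i : ℝ) • a i + μ) H =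
          R.alternatingSum (∑ i, (n i : ℝ) • a i + μ) H / R.alternatingSum (R.rho a) H) ∧
    -- the difference estimates
    (∀ A B : ℝ, 0 < A → 0 < B → ∀ k : ℕ, ∃ C : ℝ, 0 < C ∧
      ∀ N : ℝ, 1 ≤ N → ∀ H : V,
        (∀ α ∈ R.positiveRoots a,
          ‖((1 / (2 * Real.pi) * ⟪α, H⟫_ℝ : ℝ) : UnitAddCircle)‖ ≤ B * N⁻¹) →
        ∀ n : Fin r → ℤ, (∀ i, |(n i : ℝ)| ≤ A * N) →
          ∀ l : List (Fin r), l.length = k →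
            ‖iteratedDifference l
                (fun m => R.weylCharacter a (∑ i, (m i : ℝ) • a i + μ) H) n‖ ≤
              C * N ^ (((R.positiveRoots a).card : ℤ) - (k : ℤ))) := by
  exact mainTheorem6_general R a ha μ (weightLattice_le_integralWeights a hμ)
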